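/- **Counting automata.** Fix a finite alphabet $\Sigma$. A counting automaton is $A=(Q,C,I,F,\Delta)$ with a finite set $Q$ of control states and a finite set $C$ of $\mathbb N$-valued counters; a configuration is a control state (the value of the variable $s$) together with a value for every counter. $I$ and $F$ are Boolean combinations of atoms $s=q$, $c\le k$, $c\ge k$, $t_1=t_2$, where terms are $k$ or $d+k$ ($k\in\mathbb N$, $d\in C$). $\Delta$ is a finite disjunction of transitions $s=q\wedge g\wedge f\wedge s'=r$, where the guard $g$ is a Boolean combination of such atoms and of tests of the input letter, and $f$ is a conjunction of assignments $c'=t$ in which every counter is assigned at most once (an unassigned counter gets an arbitrary value). The outcome of a word is the set of configurations reachable from configurations satisfying $I$ by reading it; a word is in $L(A)$ if its outcome contains a configuration satisfying $F$. The counters are bounded: all counters have values $\le\max_A$ in all outcomes. $A$ is deterministic (a DCA) if it is a counting automaton, $I$ has at most one model, and every reachable configuration has at most one successor under each letter. **Assumption on $A$.** No counter takes part in the automaton with an unspecified value: every transition assigns every counter. More generally, it suffices that for every control state $q$ there is a set $C_q\subseteq C$ of counters in use at $q$ such that every transition assigns exactly the counters in use at its target, that, at $q$, the truth of $I$, of $F$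 and of the guards of the transitions leaving $q$ does not depend on counters outside $C_q$, that the assignment terms of these transitions mention only counters of $C_q$, and that the bound $\max_A$ is required, in configurations with control state $q$, for the counters of $C_q$ only. (The case $C_q=C$ for all $q$ is the former one.) **The algorithm.** A *sphere* is a formula $\bigvee_i (s=q_i\wedge\bigwedge_{c} c=p_{i,c})$ with parameters $p_{i,c}$ from a countable set ($c$ ranging over $C_{q_i}$). Write the set of initial configurations as a disjunction of formulas $s=q\wedge\bigwedge_{c\in C_q}c=k_c$; replacing the constants injectively by parameters gives the initial sphere $\psi_I$, and $I^d$ says $s=\psi_I$ and that each of these parameters equals the constant it replaces. Put $\psi_I$ into $Q^d$ and into the worklist. While the worklist is non-empty, remove some $\psi$ from it; bring the formula that results from $\psi\wedge\Delta$ by eliminating the counters and $s$ into disjunctive normal form, with clauses $g_\varphi\wedge f_\varphi$ ($g_\varphi$ a guard over the parameters of $\psi$ and the letter, $f_\varphi$ a conjunction of $s'=r$ and assignments). For every satisfiable minterm $g$ of the guards $g_\varphi$ let $\upsilon$ be the disjunction of the $f_\varphi$ with $g\wedge g_\varphi$ satisfiable. For every equivalence $\sim$ on the set of assignment terms of $\upsilon$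 that has at most $\max_A+1$ classes and for which the formula $\varphi_\sim$ (equivalent terms are equal, inequivalent terms are different) is satisfiable, replace the terms of $\upsilon$ by parameters, two terms by the same parameter iff they are equivalent, and drop the primes; this gives a sphere $\psi'$. If some $\sigma\in Q^d$ is logically equivalent to $\psi'$ up to a bijective renaming of the parameters, add a transition with guard $g\wedge\varphi_\sim$ from $\psi$ to $\sigma$, which assigns to each parameter of $\sigma$ (renamed accordingly) one of the terms it replaces; otherwise add the analogous transition from $\psi$ to $\psi'$, and add $\psi'$ to $Q^d$ and to the worklist. At the end, let $P$ be the set of all parameters occurring in $Q^d$, let $F^d=\bigvee_{\psi\in Q^d}(s=\psi\wedge E_\psi)$ with $E_\psi$ a quantifier-free formula over the parameters of $\psi$ obtained by eliminating the counters and $s$ from $\psi\wedge F$, let $I^d$ (every transition guard) also require $p=0$ for the parameters $p\in P$ not occurring in the initial (source) sphere, let every transition reset to $0$ the parameters of $P$ that it does not assign, and return $A^d=(Q^d,P,I^d,F^d,\Delta^d)$. **Theorem.** For every such $A$, whichever way the open choices of the algorithm are made (order of processing, disjunctive normal forms, parameters, renamings, representatives, eliminations), the algorithm terminates and outputs a deterministic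 counting automaton $A^d$ with $L(A)=L(A^d)$ and $$|Q^d|\le 2^{|Q|\cdot(\max_A+1)^{|C|}}.$$ -/

import Mathlib

/-! ## Formulas -/

/-- Boolean combinations of atoms. -/
inductive Form (α : Type*) where
  | top : Form α
  | bot : Form α
  | atom (a : α) : Form α
  | neg (φ : Form α) : Form α
  | and (φ ψ : Form α) : Form α
  | or (φ ψ : Form α) : Form α

namespace Form

/-- Truth of a formula, given the truth values of its atoms. -/
def Holds {α : Type*} (v : α → Prop) : Form α → Prop
  | top => True
  | bot => False
  | atom a => v a
  | neg φ => ¬ φ.Holds v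
  | and φ ψ => φ.Holds v ∧ ψ.Holds v
  | or φ ψ => φ.Holds v ∨ ψ.Holds v

/-- Every atom occurring in the formula satisfies `P`. -/
def All {α : Type*} (P : α → Prop) : Form α → Prop
  | top => True
  | bot => True
  | atom a => P a
  | neg φ => φ.All P
  | and φ ψ => φ.All P ∧ ψ.All P
  | or φ ψ => φ.All P ∧ ψ.All P

/-- The conjunction of the formulas `f i`, for `i` in a finite set. -/
noncomputable def conj {α ι : Type*} (s : Finset ι) (f : ι → Form α) : Form α :=
  (s.toList.map f).foldr Form.and Form.top

/-- The disjunction of the formulas `f i`, for `i` in a finite set. -/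
noncomputable def disj {α ι : Type*} (s : Finset ι) (f : ι → Form α) : Form α :=
  (s.toList.map f).foldr Form.or Form.bot

end Form

/-- Arithmetic terms `k` and `v + k` over the variables `V`. -/
inductive CTerm (V : Type*) where
  | const (k : ℕ) : CTerm V
  | add (v : V) (k : ℕ) : CTerm V

namespace CTerm

/-- The value of a term. -/
def eval {V : Type*} (α : V → ℕ) : CTerm V → ℕ
  | const k => k
  | add v k => α v + k

/-- The variable of the term, if there is one, lies in `C`. -/
def Over {V : Type*} (C : Set V) : CTerm V → Prop
  | const _ => True
  | add v _ => v ∈ C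

/-- Replacing the variable of a term according to a partial map (no result when the map is undefined
at that variable). -/
def subst {V W : Type*} (ν : V → Option W) : CTerm V → Option (CTerm W)
  | const k => some (const k)
  | add v k => (ν v).map (fun w => add w k)

end CTerm

/-- Atoms that speak about a configuration: `s = q`, `c ≤ k`, `c ≥ k` and `t₁ = t₂`. -/
inductive ConfAtom (S V : Type*) where
  | state (q : S) : ConfAtom S V
  | le (c : V) (k : ℕ) : ConfAtom S V
  | ge (c : V) (k : ℕ) : ConfAtom S V
  | eq (t₁ t₂ : CTerm V) : ConfAtom S V

namespace ConfAtom

/-- Truth of an atom in control state `s` with counter values `α`. -/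
def Holds {S V : Type*} (s : S) (α : V → ℕ) : ConfAtom S V → Prop
  | state q => s = q
  | le c k => α c ≤ k
  | ge c k => k ≤ α c
  | eq t₁ t₂ => t₁.eval α = t₂.eval α

/-- The atom mentions only control states from `Q` and counters from `C`. -/
def Over {S V : Type*} (Q : Set S) (C : Set V) : ConfAtom S V → Prop
  | state q => q ∈ Q
  | le c _ => c ∈ C
  | ge c _ => c ∈ C
  | eq t₁ t₂ => t₁.Over C ∧ t₂.Over C

end ConfAtom

/-- Atoms of transition guards: configuration atoms and tests of the input letter. -/
inductive GuardAtom (Alph S V : Type*) where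
  | letter (a : Alph) : GuardAtom Alph S V
  | conf (x : ConfAtom S V) : GuardAtom Alph S V

namespace GuardAtom

/-- Truth of a guard atom for input letter `a`, control state `s` and counter values `α`. -/
def Holds {Alph S V : Type*} (a : Alph) (s : S) (α : V → ℕ) : GuardAtom Alph S V → Prop
  | letter b => a = b
  | conf x => x.Holds s α

/-- The atom mentions only control states from `Q` and counters from `C`. -/
def Over {Alph S V : Type*} (Q : Set S) (C : Set V) : GuardAtom Alph S V → Prop
  | letter _ => True
  | conf x => x.Over Q C

end GuardAtom

/-- Formulas over configurations. -/
abbrev ConfForm (S V : Type*) := Form (ConfAtom S V)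

/-- Guard formulas. -/
abbrev GuardForm (Alph S V : Type*) := Form (GuardAtom Alph S V)

/-- `φ` is true in control state `s` with counter values `α`. -/
def ConfForm.Sat {S V : Type*} (φ : ConfForm S V) (s : S) (α : V → ℕ) : Prop :=
  Form.Holds (ConfAtom.Holds s α) φ

/-- `g` is true for input letter `a`, control state `s` and counter values `α`. -/
def GuardForm.Sat {Alph S V : Type*} (g : GuardForm Alph S V) (a : Alph) (s : S) (α : V → ℕ) :
    Prop :=
  Form.Holds (GuardAtom.Holds a s α) g

/-! ## Counting automata -/

/-- A transition `s = src ∧ guard ∧ (⋀ c' = t, over the pairs with assign c = some t) ∧ s' = tgt`.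
As `assign` is a partial function, a counter is assigned at most once. -/
structure CTransition (Alph S V : Type*) where
  src : S
  guard : GuardForm Alph S V
  assign : V → Option (CTerm V)
  tgt : S

/-- The data `(Q, C, I, F, Δ)` of a counting automaton over the alphabet `Alph`, with control states
taken from `S` and counters taken from `V`. The transition formula is the disjunction of the listed
transitions. -/
structure CAut (Alph S V : Type*) where
  states : Finset S
  counters : Finset V
  init : ConfForm S V
  final : ConfForm S V
  trans : List (CTransition Alph S V)

namespace CAut

variable {Alph S V : Type*}

/-- All components mention only control states and counters of the automaton. -/
def WellFormed (A : CAut Alph S V) : Prop :=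
  Form.All (ConfAtom.Over (A.states : Set S) (A.counters : Set V)) A.init ∧
  Form.All (ConfAtom.Over (A.states : Set S) (A.counters : Set V)) A.final ∧
  ∀ t ∈ A.trans,
    t.src ∈ A.states ∧ t.tgt ∈ A.states ∧
    Form.All (GuardAtom.Over (A.states : Set S) (A.counters : Set V)) t.guard ∧
    ∀ (c : V) (τ : CTerm V), t.assign c = some τ → c ∈ A.counters ∧ τ.Over (A.counters : Set V)

/-- The configurations: a control state together with a value for every counter. The valuation
`A.counters → ℕ` is represented by its extension by `0` to all of `V`. -/
def confs (A : CAut Alph S V) : Set (S × (V → ℕ)) :=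
  {α | α.1 ∈ A.states ∧ ∀ v, v ∉ A.counters → α.2 v = 0}

/-- `β` is an `a`-successor of `α`. A counter that the transition does not assign takes an
arbitrary value. -/
def Succ (A : CAut Alph S V) (a : Alph) (α β : S × (V → ℕ)) : Prop :=
  α ∈ A.confs ∧ β ∈ A.confs ∧
  ∃ t ∈ A.trans, α.1 = t.src ∧ t.guard.Sat a α.1 α.2 ∧
    (∀ (c : V) (τ : CTerm V), t.assign c = some τ → β.2 c = τ.eval α.2) ∧ β.1 = t.tgt

/-- `β` is a `w`-successor of `α`. -/
def SuccWord (A : CAut Alph S V) : List Alph → (S × (V → ℕ)) → (S × (V → ℕ)) → Prop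
  | [], α, β => α = β
  | a :: w, α, β => ∃ γ, A.Succ a α γ ∧ A.SuccWord w γ β

/-- The initial configurations. -/
def Initial (A : CAut Alph S V) : Set (S × (V → ℕ)) :=
  {α | α ∈ A.confs ∧ A.init.Sat α.1 α.2}

/-- The outcome of a word: all its successors of initial configurations. -/
def outcome (A : CAut Alph S V) (w : List Alph) : Set (S × (V → ℕ)) :=
  {β | ∃ α ∈ A.Initial, A.SuccWord w α β}

/-- The accepted language. -/
def language (A : CAut Alph S V) : Language Alph :=
  {w | ∃ β ∈ A.outcome w, A.final.Sat β.1 β.2}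

/-- A counting automaton: well formed, and some constant bounds every counter in every
configuration of every outcome. -/
def IsCA (A : CAut Alph S V) : Prop :=
  A.WellFormed ∧
  ∃ m : ℕ, ∀ (w : List Alph), ∀ β ∈ A.outcome w, ∀ c ∈ A.counters, β.2 c ≤ m

/-- A deterministic counting automaton: the initial formula has at most one model, and every
reachable configuration has at most one successor for every letter. -/
def IsDCA (A : CAut Alph S V) : Prop :=
  A.IsCA ∧ A.Initial.Subsingleton ∧
  ∀ (w : List Alph), ∀ α ∈ A.outcome w, ∀ (a : Alph) (β γ : S × (V → ℕ)),
    A.Succ a α β → A.Succ a α γ → β = γ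

/-- `D q` is the set of counters *in use* at the control state `q`: a transition assigns exactly the
counters in use at its target, and a counter that is not in use at `q` (whose value is arbitrary
there) has no influence: the initial and the final formula, the guards of the transitions leaving
`q`, and their assignment terms do not depend on it. -/
structure InUse (A : CAut Alph S V) (D : S → Finset V) : Prop where
  subset : ∀ q ∈ A.states, D q ⊆ A.counters
  init : ∀ q ∈ A.states, ∀ α β : V → ℕ, (∀ c ∈ D q, α c = β c) →
    (A.init.Sat q α ↔ A.init.Sat q β)
  final : ∀ q ∈ A.states, ∀ α β : V → ℕ, (∀ c ∈ D q, α c = β c) →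
    (A.final.Sat q α ↔ A.final.Sat q β)
  guard : ∀ t ∈ A.trans, ∀ (a : Alph) (α β : V → ℕ), (∀ c ∈ D t.src, α c = β c) →
    (t.guard.Sat a t.src α ↔ t.guard.Sat a t.src β)
  term : ∀ t ∈ A.trans, ∀ (c : V) (τ : CTerm V), t.assign c = some τ → τ.Over (D t.src : Set V)
  assign : ∀ t ∈ A.trans, ∀ c : V, t.assign c ≠ none ↔ c ∈ D t.tgt

/-- In every outcome, the counters in use have values at most `m`. For `D q = C` this is the
boundedness condition on counting automata. -/
def BoundedBy (A : CAut Alph S V) (D : S → Finset V) (m : ℕ) : Prop :=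
  ∀ (w : List Alph), ∀ β ∈ A.outcome w, ∀ c ∈ D β.1, β.2 c ≤ m

end CAut

/-! ## Spheres -/

/-- Disjunctions of conjunctions `s = q ∧ ⋀ c = x`, one conjunct `c = x` for every counter `c` to
which the partial function assigns a symbol `x`. -/
abbrev EqForm (S V X : Type*) := Finset (S × (V → Option X))

/-- Spheres: the symbols are parameters; the countable set of parameters is `ℕ`. -/
abbrev Sphere (S V : Type*) := EqForm S V ℕ

namespace EqForm

variable {S V X Y : Type*}

/-- Truth of the disjunction in control state `s` with counter values `α`, when the value of the
symbol `x` is `η x`. -/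
def Sat (Ψ : EqForm S V X) (s : S) (α : V → ℕ) (η : X → ℕ) : Prop :=
  ∃ d ∈ Ψ, s = d.1 ∧ ∀ (c : V) (x : X), d.2 c = some x → α c = η x

open Classical in
/-- The symbols that occur in the disjunction (next to counters from `C`). -/
noncomputable def symbols (C : Finset V) (Ψ : EqForm S V X) : Finset X :=
  Ψ.biUnion fun d => C.biUnion fun c => (d.2 c).toFinset

open Classical in
/-- Replacing every symbol `x` by `f x`. -/
noncomputable def replace (f : X → Y) (Ψ : EqForm S V X) : EqForm S V Y :=
  Ψ.image fun d => (d.1, fun c => (d.2 c).map f)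

/-- Logical equivalence. -/
def Equivalent (Ψ Ψ' : EqForm S V X) : Prop :=
  ∀ (s : S) (α : V → ℕ) (η : X → ℕ), Sat Ψ s α η ↔ Sat Ψ' s α η

end EqForm

/-! ## The determinisation algorithm -/

/-- A pending iteration of the inner loop: the sphere being processed, a factor consisting of a
guard and an update, and an equivalence on the assignment terms of the update. -/
structure Job (Alph S V : Type*) (C : Finset V) where
  src : Sphere S V
  guard : GuardForm Alph (Sphere S V) ℕ
  upd : EqForm S V (CTerm ℕ)
  rel : Setoid {t : CTerm ℕ // t ∈ EqForm.symbols C upd}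

/-- The state of a run. `init` is the initial sphere, `initForm` the initial formula. -/
structure RunState (Alph S V : Type*) (C : Finset V) where
  init : Sphere S V
  initForm : ConfForm (Sphere S V) ℕ
  states : Finset (Sphere S V)
  worklist : Finset (Sphere S V)
  trans : List (CTransition Alph (Sphere S V) ℕ)
  todo : Set (Job Alph S V C)

namespace Job

variable {Alph S V : Type*} {C : Finset V}

open Classical in
/-- The formula that requires that the `∼`-equivalent assignment terms have equal values and that
the other pairs of assignment terms have different values. -/
noncomputable def phi (j : Job Alph S V C) : GuardForm Alph (Sphere S V) ℕ :=
  Form.conj ((EqForm.symbols C j.upd).attach ×ˢ (EqForm.symbols C j.upd).attach) fun p =>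
    if j.rel p.1 p.2 then
      Form.atom (GuardAtom.conf (ConfAtom.eq p.1.1 p.2.1))
    else
      Form.neg (Form.atom (GuardAtom.conf (ConfAtom.eq p.1.1 p.2.1)))

/-- A replacement of the assignment terms by parameters that identifies exactly the
`∼`-equivalent terms. -/
def Respects (j : Job Alph S V C) (f : CTerm ℕ → ℕ) : Prop :=
  ∀ t u : {t : CTerm ℕ // t ∈ EqForm.symbols C j.upd}, f t.1 = f u.1 ↔ j.rel t u

/-- `asg` assigns to every parameter in the image of `f` one of the (on the guard `j.phi` equal)
terms that `f` replaces by it, and nothing to the other parameters. -/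
def IsAssignment (j : Job Alph S V C) (f : CTerm ℕ → ℕ) (asg : ℕ → Option (CTerm ℕ)) : Prop :=
  (∀ (p : ℕ) (t : CTerm ℕ), asg p = some t → t ∈ EqForm.symbols C j.upd ∧ f t = p) ∧
  ∀ t ∈ EqForm.symbols C j.upd, asg (f t) ≠ none

end Job

namespace CAut

variable {Alph S V : Type*}

/-- The update obtained from a disjunct `d` of a sphere and a transition `t`, by eliminating the
counters through the equations in `d`. -/
def update (d : S × (V → Option ℕ)) (t : CTransition Alph S V) : S × (V → Option (CTerm ℕ)) :=
  (t.tgt, fun c => (t.assign c).bind (CTerm.subst d.2))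

/-- `X` is a set of clauses, each a guard over the parameters of `ψ` and the input letter together
with a conjunctive update, whose disjunction is a disjunctive normal form of `ψ ∧ Δ` after the
elimination of the counters and the control state variable. -/
def IsClauses (A : CAut Alph S V) (ψ : Sphere S V)
    (X : Finset (GuardForm Alph (Sphere S V) ℕ × (S × (V → Option (CTerm ℕ))))) : Prop :=
  (∀ x ∈ X, Form.All
    (GuardAtom.Over (∅ : Set (Sphere S V)) (EqForm.symbols A.counters ψ : Set ℕ)) x.1) ∧
  ∀ (η : ℕ → ℕ) (a : Alph) (u : S × (V → Option (CTerm ℕ))),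
    (∃ g : GuardForm Alph (Sphere S V) ℕ, (g, u) ∈ X ∧ g.Sat a ψ η) ↔
    ∃ d ∈ ψ, ∃ t ∈ A.trans, d.1 = t.src ∧ u = update d t ∧
      ∃ α : V → ℕ, (d.1, α) ∈ A.confs ∧
        (∀ (c : V) (p : ℕ), d.2 c = some p → α c = η p) ∧ t.guard.Sat a d.1 α

open Classical in
/-- The minterm of the finite set `G` of guards in which exactly the guards from `G'` are positive. -/
noncomputable def minterm (G G' : Finset (GuardForm Alph (Sphere S V) ℕ)) :
    GuardForm Alph (Sphere S V) ℕ :=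
  Form.and (Form.conj G' fun g => g) (Form.conj (G \ G') fun g => Form.neg g)

open Classical in
/-- The iterations of the inner loops for the sphere `ψ`: one for every factor (a satisfiable minterm
of the guards of the clauses, with the disjunction of the updates of the clauses compatible with it)
and every equivalence on the assignment terms of its update that is satisfiable and has at most
`m + 1` classes. -/
def jobs (A : CAut Alph S V) (m : ℕ) (ψ : Sphere S V)
    (X : Finset (GuardForm Alph (Sphere S V) ℕ × (S × (V → Option (CTerm ℕ))))) :
    Set (Job Alph S V A.counters) :=
  {j | j.src = ψ ∧
    (∃ G' ⊆ X.image Prod.fst,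
      j.guard = minterm (X.image Prod.fst) G' ∧
      (∃ (a : Alph) (η : ℕ → ℕ), j.guard.Sat a ψ η) ∧
      j.upd = (X.filter fun x => x.1 ∈ G').image Prod.snd) ∧
    (∃ (a : Alph) (η : ℕ → ℕ), j.phi.Sat a ψ η) ∧
    Nat.card (Quotient j.rel) ≤ m + 1}

/-- The states in which a run may begin. `Φ` represents the set of initial configurations by
equations between counters (those in use) and constants; the initial sphere arises from `Φ` by
injectively replacing the constants by parameters, and the initial formula equates these parameters
with the constants they replace. -/
def IsStart (A : CAut Alph S V) (D : S → Finset V) (st : RunState Alph S V A.counters) : Prop :=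
  ∃ (Φ : EqForm S V ℕ) (f : ℕ → ℕ),
    (∀ d ∈ Φ, d.1 ∈ A.states ∧ ∀ c : V, d.2 c ≠ none ↔ c ∈ D d.1) ∧
    (∀ α ∈ A.confs, A.init.Sat α.1 α.2 ↔ EqForm.Sat Φ α.1 α.2 (fun k => k)) ∧
    Set.InjOn f (EqForm.symbols A.counters Φ : Set ℕ) ∧
    st.init = EqForm.replace f Φ ∧
    st.initForm = Form.and (Form.atom (ConfAtom.state st.init))
      (Form.conj (EqForm.symbols A.counters Φ) fun k =>
        Form.atom (ConfAtom.eq (CTerm.add (f k) 0) (CTerm.const k))) ∧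
    st.states = {st.init} ∧ st.worklist = {st.init} ∧ st.trans = [] ∧ st.todo = ∅

open Classical in
/-- One step of a run: taking a sphere from the worklist (once the inner loops for the previous one
have ended), or one iteration of the inner loops, which adds a transition either into an
old sphere that is equivalent to the computed one up to a renaming of the parameters, or, if there is
none, into the computed sphere, which is then added. All choices that the algorithm leaves open are
arbitrary. -/
inductive Step (A : CAut Alph S V) (m : ℕ) :
    RunState Alph S V A.counters → RunState Alph S V A.counters → Prop
  | pop (st : RunState Alph S V A.counters) (ψ : Sphere S V)
      (X : Finset (GuardForm Alph (Sphere S V) ℕ × (S × (V → Option (CTerm ℕ)))))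
      (htodo : st.todo = ∅) (hψ : ψ ∈ st.worklist) (hX : A.IsClauses ψ X) :
      Step A m st { st with worklist := st.worklist.erase ψ, todo := A.jobs m ψ X }
  | old (st : RunState Alph S V A.counters) (j : Job Alph S V A.counters)
      (f : CTerm ℕ → ℕ) (asg : ℕ → Option (CTerm ℕ)) (ρ : Equiv.Perm ℕ) (σ : Sphere S V)
      (hj : j ∈ st.todo) (hf : j.Respects f) (hasg : j.IsAssignment f asg) (hσ : σ ∈ st.states)
      (hρ : EqForm.Equivalent (EqForm.replace ρ (EqForm.replace f j.upd)) σ) :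
      Step A m st { st with
        trans := ⟨j.src, Form.and j.guard j.phi, fun p => asg (ρ.symm p), σ⟩ :: st.trans
        todo := st.todo \ {j} }
  | new (st : RunState Alph S V A.counters) (j : Job Alph S V A.counters)
      (f : CTerm ℕ → ℕ) (asg : ℕ → Option (CTerm ℕ))
      (hj : j ∈ st.todo) (hf : j.Respects f) (hasg : j.IsAssignment f asg)
      (hnew : ¬ ∃ (ρ : Equiv.Perm ℕ), ∃ σ ∈ st.states,
        EqForm.Equivalent (EqForm.replace ρ (EqForm.replace f j.upd)) σ) :
      Step A m st { st with
        states := insert (EqForm.replace f j.upd) st.states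
        worklist := insert (EqForm.replace f j.upd) st.worklist
        trans := ⟨j.src, Form.and j.guard j.phi, asg, EqForm.replace f j.upd⟩ :: st.trans
        todo := st.todo \ {j} }

/-- The loops have ended. -/
def Finished (A : CAut Alph S V) (st : RunState Alph S V A.counters) : Prop :=
  st.worklist = ∅ ∧ st.todo = ∅

open Classical in
/-- The parameters found in the constructed spheres. -/
noncomputable def params (A : CAut Alph S V) (st : RunState Alph S V A.counters) : Finset ℕ :=
  st.states.biUnion fun ψ => EqForm.symbols A.counters ψ

open Classical in
/-- Grounding of the initial formula: the parameters that do not occur in the initial sphere are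
`0`. -/
noncomputable def groundInit (A : CAut Alph S V) (st : RunState Alph S V A.counters) :
    ConfForm (Sphere S V) ℕ :=
  Form.and st.initForm
    (Form.conj (A.params st \ EqForm.symbols A.counters st.init) fun p =>
      Form.atom (ConfAtom.eq (CTerm.add p 0) (CTerm.const 0)))

open Classical in
/-- Grounding of a transition: the guard also tests that the parameters that do not occur in the
source sphere are `0`, and the parameters that are not assigned are reset to `0`. -/
noncomputable def groundTrans (A : CAut Alph S V) (st : RunState Alph S V A.counters)
    (t : CTransition Alph (Sphere S V) ℕ) : CTransition Alph (Sphere S V) ℕ where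
  src := t.src
  guard := Form.and t.guard
    (Form.conj (A.params st \ EqForm.symbols A.counters t.src) fun p =>
      Form.atom (GuardAtom.conf (ConfAtom.eq (CTerm.add p 0) (CTerm.const 0))))
  assign := fun p =>
    if p ∈ A.params st then some ((t.assign p).getD (CTerm.const 0)) else t.assign p
  tgt := t.tgt

/-- `B` is returned by the algorithm when its loops end in the state `st`. The final formula is the
disjunction, over the constructed spheres `ψ`, of `s = ψ ∧ E ψ`, where `E ψ` is a quantifier-free
formula over the parameters of `ψ` that results from `ψ ∧ F` by eliminating the counters and the
control state variable. -/
def IsOutput (A : CAut Alph S V) (st : RunState Alph S V A.counters)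
    (B : CAut Alph (Sphere S V) ℕ) : Prop :=
  B.states = st.states ∧
  B.counters = A.params st ∧
  B.init = A.groundInit st ∧
  B.trans = st.trans.map (A.groundTrans st) ∧
  ∃ E : Sphere S V → ConfForm (Sphere S V) ℕ,
    (∀ ψ ∈ st.states,
      Form.All (ConfAtom.Over (∅ : Set (Sphere S V)) (EqForm.symbols A.counters ψ : Set ℕ)) (E ψ) ∧
      ∀ η : ℕ → ℕ, (E ψ).Sat ψ η ↔
        ∃ α ∈ A.confs, EqForm.Sat ψ α.1 α.2 η ∧ A.final.Sat α.1 α.2) ∧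
    B.final = Form.disj st.states fun ψ => Form.and (Form.atom (ConfAtom.state ψ)) (E ψ)

end CAut

/-! A sphere together with a valuation of its parameters denotes a set of configurations of `A`. The
output automaton moves through such pairs in such a way that, after reading `w`, the pair it has
reached denotes exactly the outcome of `w` (`Describes`).

Fix a sphere, a valuation `η` and a letter. Exactly one minterm of the clause guards is true, and it
selects precisely the updates of those transitions that are enabled at some denoted configuration
(`mem_upd_of_sat`). Evaluated under `η`, these updates denote the set of successors
(`InUse.exists_succ_iff`). The equalities between the values of the assignment terms single out one
equivalence, and this says which terms may share a parameter of the next sphere. So at most one job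
fits (`eq_of_mem_jobs_of_sat`); with grounding, which fixes every remaining parameter to `0`, this
yields determinism.

The bound `m` enters twice. The values of the assignment terms are counter values in an outcome, so
they take at most `m + 1` different values, and the restriction to `m + 1` classes discards no job
that is needed (`IsFactor.exists_job`, `IsOutput.exists_succ`). Conversely, the restriction leaves
at most `m + 1` parameters in each sphere. Renamed to `0, …, m`, a sphere is a subset of a fixed set
of at most `|Q| * (m + 1) ^ |C|` disjuncts. As no two constructed spheres are renamings of each
other, this bounds their number (`card_le_of_distinct`), and termination follows from a
lexicographic measure.

Counters that are not in use may be given the value `0` when variables are eliminated, because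
`InUse` makes formulas insensitive to them. -/

/-! ### Connectives, quantifier-free replacement of atoms, and the symbols they mention. -/

namespace Form

variable {α β ι : Type*}

theorem holds_conj (v : α → Prop) (s : Finset ι) (f : ι → Form α) :
    (conj s f).Holds v ↔ ∀ i ∈ s, (f i).Holds v := by
  have h : ∀ l : List ι, ((l.map f).foldr Form.and Form.top).Holds v ↔
      ∀ i ∈ l, (f i).Holds v := by
    intro l
    induction l with
    | nil => simp [Holds]
    | cons a l ih => simp [Holds, ih]
  simpa [conj] using h s.toList

theorem holds_disj (v : α → Prop) (s : Finset ι) (f : ι → Form α) :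
    (disj s f).Holds v ↔ ∃ i ∈ s, (f i).Holds v := by
  have h : ∀ l : List ι, ((l.map f).foldr Form.or Form.bot).Holds v ↔
      ∃ i ∈ l, (f i).Holds v := by
    intro l
    induction l with
    | nil => simp [Holds]
    | cons a l ih => simp [Holds, ih]
  simpa [disj] using h s.toList

theorem all_conj {P : α → Prop} {s : Finset ι} {f : ι → Form α} (h : ∀ i ∈ s, (f i).All P) :
    (conj s f).All P := by
  have h' : ∀ l : List ι, (∀ i ∈ l, (f i).All P) →
      ((l.map f).foldr Form.and Form.top).All P := by
    intro l hl
    induction l with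
    | nil => simp [All]
    | cons a l ih =>
      exact ⟨hl a (by simp), ih fun i hi => hl i (by simp [hi])⟩
  exact h' s.toList (by simpa using h)

theorem all_disj {P : α → Prop} {s : Finset ι} {f : ι → Form α} (h : ∀ i ∈ s, (f i).All P) :
    (disj s f).All P := by
  have h' : ∀ l : List ι, (∀ i ∈ l, (f i).All P) →
      ((l.map f).foldr Form.or Form.bot).All P := by
    intro l hl
    induction l with
    | nil => simp [All]
    | cons a l ih =>
      exact ⟨hl a (by simp), ih fun i hi => hl i (by simp [hi])⟩
  exact h' s.toList (by simpa using h)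

theorem All.mono {P R : α → Prop} (h : ∀ a, P a → R a) : ∀ {φ : Form α}, φ.All P → φ.All R
  | top, _ => trivial
  | bot, _ => trivial
  | atom a, hφ => h a hφ
  | neg φ, hφ => All.mono (φ := φ) h hφ
  | and φ ψ, hφ => ⟨All.mono (φ := φ) h hφ.1, All.mono (φ := ψ) h hφ.2⟩
  | or φ ψ, hφ => ⟨All.mono (φ := φ) h hφ.1, All.mono (φ := ψ) h hφ.2⟩

/-- Replacing every atom by a formula. -/
def bind (f : α → Form β) : Form α → Form β
  | top => top
  | bot => bot
  | atom a => f a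
  | neg φ => neg (φ.bind f)
  | and φ ψ => and (φ.bind f) (ψ.bind f)
  | or φ ψ => or (φ.bind f) (ψ.bind f)

theorem holds_bind {f : α → Form β} {v : β → Prop} {w : α → Prop}
    (h : ∀ a, (f a).Holds v ↔ w a) (φ : Form α) : (φ.bind f).Holds v ↔ φ.Holds w := by
  induction φ with
  | top => rfl
  | bot => rfl
  | atom a => exact h a
  | neg φ ih => exact not_congr ih
  | and φ ψ ih₁ ih₂ => exact and_congr ih₁ ih₂
  | or φ ψ ih₁ ih₂ => exact or_congr ih₁ ih₂

theorem all_bind {f : α → Form β} {P : β → Prop} (h : ∀ a, (f a).All P) (φ : Form α) :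
    (φ.bind f).All P := by
  induction φ with
  | top => trivial
  | bot => trivial
  | atom a => exact h a
  | neg φ ih => exact ih
  | and φ ψ ih₁ ih₂ => exact ⟨ih₁, ih₂⟩
  | or φ ψ ih₁ ih₂ => exact ⟨ih₁, ih₂⟩

end Form

/-! ## Elimination of counters -/

/-- The valuation that a partial map to parameters induces, with value `0` where it is undefined. -/
def pullback {V W : Type*} (ν : V → Option W) (η : W → ℕ) (c : V) : ℕ :=
  (ν c).elim 0 η

theorem pullback_of_eq_some {V W : Type*} {ν : V → Option W} (η : W → ℕ) {c : V} {p : W}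
    (h : ν c = some p) : pullback ν η c = η p := by
  simp [pullback, h]

namespace CTerm

variable {V W : Type*}

/-- Replacing the variable of a term by its parameter, or by `0` if it has none. -/
def elim (ν : V → Option W) : CTerm V → CTerm W
  | const k => const k
  | add v k => (ν v).elim (const k) fun p => add p k

theorem eval_elim (ν : V → Option W) (η : W → ℕ) (t : CTerm V) :
    (t.elim ν).eval η = t.eval (pullback ν η) := by
  cases t with
  | const k => rfl
  | add v k => cases h : ν v <;> simp [elim, eval, pullback, h]

theorem over_elim {ν : V → Option W} {P : Set W} (h : ∀ c p, ν c = some p → p ∈ P) (t : CTerm V) :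
    (t.elim ν).Over P := by
  cases t with
  | const k => trivial
  | add v k =>
    cases hv : ν v with
    | none => simp [elim, hv, Over]
    | some p => simpa [elim, hv, Over] using h v p hv

theorem eval_of_subst_eq_some {ν : V → Option W} {α : V → ℕ} {η : W → ℕ}
    (h : ∀ c p, ν c = some p → α c = η p) {t : CTerm V} {u : CTerm W}
    (hu : t.subst ν = some u) : u.eval η = t.eval α := by
  cases t with
  | const k =>
    obtain rfl : const k = u := by simpa [subst] using hu
    rfl
  | add v k =>
    obtain ⟨p, hp, rfl⟩ : ∃ p, ν v = some p ∧ add p k = u := by simpa [subst] using hu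
    simp [eval, h v p hp]

theorem over_of_subst_eq_some {ν : V → Option W} {P : Set W} (h : ∀ c p, ν c = some p → p ∈ P)
    {t : CTerm V} {u : CTerm W} (hu : t.subst ν = some u) : u.Over P := by
  cases t with
  | const k =>
    obtain rfl : const k = u := by simpa [subst] using hu
    trivial
  | add v k =>
    obtain ⟨p, hp, rfl⟩ : ∃ p, ν v = some p ∧ add p k = u := by simpa [subst] using hu
    exact h v p hp

theorem exists_subst_eq_some {ν : V → Option W} {t : CTerm V} (h : t.Over {c | ν c ≠ none}) :
    ∃ u, t.subst ν = some u := by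
  cases t with
  | const k => exact ⟨_, rfl⟩
  | add v k =>
    obtain ⟨p, hp⟩ := Option.ne_none_iff_exists'.1 h
    exact ⟨add p k, by simp [subst, hp]⟩

theorem Over.mono {C C' : Set V} (h : C ⊆ C') {t : CTerm V} (ht : t.Over C) : t.Over C' := by
  cases t with
  | const k => trivial
  | add v k => exact h ht

end CTerm

namespace ConfAtom

variable {S V S' W : Type*}

open Classical in
/-- Elimination of the control state and the counters from an atom. -/
noncomputable def elim (q : S) (ν : V → Option W) : ConfAtom S V → ConfForm S' W
  | state r => if q = r then Form.top else Form.bot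
  -- A counter without a parameter counts as `0`: then `c ≤ k` is true, and `c ≥ k` is true only for
  -- `k = 0`.
  | le c k => (ν c).elim Form.top fun p => Form.atom (le p k)
  | ge c k => (ν c).elim (if k = 0 then Form.top else Form.bot) fun p => Form.atom (ge p k)
  | eq t u => Form.atom (eq (t.elim ν) (u.elim ν))

theorem sat_elim (q : S) (ν : V → Option W) (s : S') (η : W → ℕ) (x : ConfAtom S V) :
    Form.Holds (Holds s η) (x.elim q ν) ↔ x.Holds q (pullback ν η) := by
  cases x with
  | state r => by_cases h : q = r <;> simp [elim, Form.Holds, Holds, h]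
  | le c k => cases h : ν c <;> simp [elim, Form.Holds, Holds, pullback, h]
  | ge c k =>
    cases h : ν c with
    | none => by_cases hk : k = 0 <;> simp [elim, Form.Holds, Holds, pullback, h, hk]
    | some p => simp [elim, Form.Holds, Holds, pullback, h]
  | eq t u => simp [elim, Form.Holds, Holds, CTerm.eval_elim]

theorem over_elim {ν : V → Option W} {P : Set W} (h : ∀ c p, ν c = some p → p ∈ P) (q : S)
    (x : ConfAtom S V) : Form.All (Over (∅ : Set S') P) (x.elim q ν) := by
  cases x with
  | state r => by_cases hr : q = r <;> simp [elim, Form.All, hr]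
  | le c k =>
    cases hc : ν c with
    | none => simp [elim, Form.All, hc]
    | some p => simpa [elim, Form.All, hc, Over] using h c p hc
  | ge c k =>
    cases hc : ν c with
    | none => by_cases hk : k = 0 <;> simp [elim, Form.All, hc, hk]
    | some p => simpa [elim, Form.All, hc, Over] using h c p hc
  | eq t u => exact ⟨CTerm.over_elim h t, CTerm.over_elim h u⟩

theorem Over.mono {Q Q' : Set S} {C C' : Set V} (hQ : Q ⊆ Q') (hC : C ⊆ C') {x : ConfAtom S V}
    (hx : x.Over Q C) : x.Over Q' C' := by
  cases x with
  | state q => exact hQ hx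
  | le c k => exact hC hx
  | ge c k => exact hC hx
  | eq t u => exact ⟨hx.1.mono hC, hx.2.mono hC⟩

end ConfAtom

namespace GuardAtom

variable {Alph S V S' W : Type*}

/-- Elimination of the control state and the counters from a guard atom. -/
noncomputable def elim (q : S) (ν : V → Option W) : GuardAtom Alph S V → GuardForm Alph S' W
  | letter a => Form.atom (letter a)
  | conf x => Form.bind (fun y => Form.atom (conf y)) (x.elim q ν)

theorem sat_elim (q : S) (ν : V → Option W) (a : Alph) (s : S') (η : W → ℕ)
    (x : GuardAtom Alph S V) :
    Form.Holds (Holds a s η) (x.elim q ν) ↔ x.Holds a q (pullback ν η) := by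
  cases x with
  | letter b => rfl
  | conf x =>
    exact (Form.holds_bind (w := ConfAtom.Holds s η) (fun _ => Iff.rfl) _).trans
      (ConfAtom.sat_elim q ν s η x)

theorem over_elim {ν : V → Option W} {P : Set W} (h : ∀ c p, ν c = some p → p ∈ P) (q : S)
    (x : GuardAtom Alph S V) : Form.All (Over (∅ : Set S') P) (x.elim q ν) := by
  have aux : ∀ φ : ConfForm S' W, Form.All (ConfAtom.Over (∅ : Set S') P) φ →
      Form.All (Over (∅ : Set S') P)
        (Form.bind (fun y => Form.atom (conf y) : _ → GuardForm Alph S' W) φ) := by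
    intro φ hφ
    induction φ with
    | top => trivial
    | bot => trivial
    | atom a => exact hφ
    | neg φ ih => exact ih hφ
    | and φ ψ ih₁ ih₂ => exact ⟨ih₁ hφ.1, ih₂ hφ.2⟩
    | or φ ψ ih₁ ih₂ => exact ⟨ih₁ hφ.1, ih₂ hφ.2⟩
  cases x with
  | letter b => trivial
  | conf x => exact aux _ (ConfAtom.over_elim h q x)

theorem Over.mono {Q Q' : Set S} {C C' : Set V} (hQ : Q ⊆ Q') (hC : C ⊆ C')
    {x : GuardAtom Alph S V} (hx : x.Over Q C) : x.Over Q' C' := by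
  cases x with
  | letter a => trivial
  | conf x => exact ConfAtom.Over.mono hQ hC hx

end GuardAtom

/-! ## Disjunctions of equations -/

namespace EqForm

variable {S V X Y Z : Type*}

/-- The control states belong to `Q`, and a disjunct for the control state `q` determines exactly the
counters in `D q`. -/
def Shaped (Q : Finset S) (D : S → Finset V) (Ψ : EqForm S V X) : Prop :=
  ∀ d ∈ Ψ, d.1 ∈ Q ∧ ∀ c : V, d.2 c ≠ none ↔ c ∈ D d.1

theorem mem_symbols {C : Finset V} {Ψ : EqForm S V X} {x : X} :
    x ∈ symbols C Ψ ↔ ∃ d ∈ Ψ, ∃ c ∈ C, d.2 c = some x := by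
  simp [symbols]

theorem mem_replace {f : X → Y} {Ψ : EqForm S V X} {e : S × (V → Option Y)} :
    e ∈ replace f Ψ ↔ ∃ d ∈ Ψ, (d.1, fun c => (d.2 c).map f) = e := by
  simp only [replace, Finset.mem_image]

theorem replace_replace (g : Y → Z) (f : X → Y) (Ψ : EqForm S V X) :
    replace g (replace f Ψ) = replace (g ∘ f) Ψ := by
  ext e
  simp [mem_replace]

theorem replace_eq_self {f : X → X} (hf : ∀ x, f x = x) (Ψ : EqForm S V X) :
    replace f Ψ = Ψ := by
  obtain rfl : f = id := funext hf
  ext e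
  simp [mem_replace]

theorem sat_replace (f : X → Y) (Ψ : EqForm S V X) (s : S) (α : V → ℕ) (η : Y → ℕ) :
    Sat (replace f Ψ) s α η ↔ Sat Ψ s α (η ∘ f) := by
  constructor
  · rintro ⟨e, he, hs, h⟩
    obtain ⟨d, hd, rfl⟩ := mem_replace.1 he
    exact ⟨d, hd, hs, fun c x hx => h c (f x) (by simp [hx])⟩
  · rintro ⟨d, hd, hs, h⟩
    refine ⟨_, mem_replace.2 ⟨d, hd, rfl⟩, hs, fun c y hy => ?_⟩
    obtain ⟨x, hx, rfl⟩ : ∃ x, d.2 c = some x ∧ f x = y := by simpa using hy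
    exact h c x hx

theorem mem_symbols_replace {C : Finset V} {f : X → Y} {Ψ : EqForm S V X} {y : Y} :
    y ∈ symbols C (replace f Ψ) ↔ ∃ x ∈ symbols C Ψ, f x = y := by
  simp only [mem_symbols, mem_replace]
  constructor
  · rintro ⟨e, ⟨d, hd, rfl⟩, c, hc, h⟩
    obtain ⟨x, hx, rfl⟩ : ∃ x, d.2 c = some x ∧ f x = y := by simpa using h
    exact ⟨x, ⟨d, hd, c, hc, hx⟩, rfl⟩
  · rintro ⟨x, ⟨d, hd, c, hc, hx⟩, rfl⟩
    exact ⟨_, ⟨d, hd, rfl⟩, c, hc, by simp [hx]⟩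

namespace Shaped

variable {Q : Finset S} {D : S → Finset V} {C : Finset V}

theorem replace {Ψ : EqForm S V X} (h : Shaped Q D Ψ) (f : X → Y) :
    Shaped Q D (EqForm.replace f Ψ) := by
  intro e he
  obtain ⟨d, hd, rfl⟩ := mem_replace.1 he
  exact ⟨(h d hd).1, fun c => by simpa using (h d hd).2 c⟩

theorem mem_symbols {Ψ : EqForm S V X} (h : Shaped Q D Ψ) (hC : ∀ q ∈ Q, D q ⊆ C)
    {d : S × (V → Option X)} (hd : d ∈ Ψ) {c : V} {x : X} (hx : d.2 c = some x) :
    x ∈ symbols C Ψ :=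
  EqForm.mem_symbols.2 ⟨d, hd, c, hC _ (h d hd).1 (((h d hd).2 c).1 (by simp [hx])), hx⟩

theorem sat_congr {Ψ : EqForm S V X} (h : Shaped Q D Ψ) (hC : ∀ q ∈ Q, D q ⊆ C)
    {η θ : X → ℕ} (hη : ∀ x ∈ symbols C Ψ, η x = θ x) (s : S) (α : V → ℕ) :
    Sat Ψ s α η ↔ Sat Ψ s α θ := by
  refine exists_congr fun d => and_congr_right fun hd => and_congr_right fun _ =>
    forall_congr' fun c => forall_congr' fun x => forall_congr' fun hx => ?_
  rw [hη x (h.mem_symbols hC hd hx)]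

/-- A disjunct can be recovered from a model. This makes the equivalence test of the algorithm an
equality test for spheres of the right shape. -/
theorem subset_of_equivalent {Ψ Ψ' : Sphere S V} (h : Shaped Q D Ψ) (h' : Shaped Q D Ψ')
    (he : Equivalent Ψ Ψ') : Ψ ⊆ Ψ' := by
  intro d hd
  -- Letting every parameter denote itself turns `d` into a model of `Ψ`. The disjunct `e` of `Ψ'`
  -- true there has the same control state, hence the same counters, and distinct parameters have
  -- distinct values.
  obtain ⟨e, he', hs, hv⟩ := (he d.1 (pullback d.2 id) id).1
    ⟨d, hd, rfl, fun c x hx => pullback_of_eq_some id hx⟩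
  have : e = d := by
    refine Prod.ext hs.symm (funext fun c => ?_)
    have h₁ := (h d hd).2 c
    have h₂ := (h' e he').2 c
    rw [← hs, ← h₁] at h₂
    cases hx : e.2 c with
    | none =>
      by_contra hn
      exact h₂.2 (Ne.symm hn) hx
    | some x =>
      obtain ⟨y, hy⟩ := Option.ne_none_iff_exists'.1 (h₂.1 (by simp [hx]))
      have := hv c x hx
      rw [pullback_of_eq_some id hy] at this
      rw [hy, ← show y = x from this]
  exact this ▸ he'

theorem eq_of_equivalent {Ψ Ψ' : Sphere S V} (h : Shaped Q D Ψ) (h' : Shaped Q D Ψ')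
    (he : Equivalent Ψ Ψ') : Ψ = Ψ' :=
  (h.subset_of_equivalent h' he).antisymm
    (h'.subset_of_equivalent h fun s α η => (he s α η).symm)

end Shaped

theorem equivalent_of_eq {Ψ Ψ' : EqForm S V X} (h : Ψ = Ψ') : Equivalent Ψ Ψ' :=
  fun _ _ _ => by rw [h]

/-! ### Counting spheres up to renaming -/

/-- The permutations of `ℕ` act multiply transitively, so the enumeration of `s` can be carried to
the initial segment of `ℕ` of the same length. -/
theorem exists_perm_lt {s : Finset ℕ} {n : ℕ} (hs : s.card ≤ n) :
    ∃ π : Equiv.Perm ℕ, ∀ p ∈ s, π p < n := by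
  obtain ⟨g, hg⟩ := (Equiv.Perm.isMultiplyPretransitive ℕ s.card).exists_smul_eq
    (s.orderEmbOfFin rfl).toEmbedding (Fin.valEmbedding (n := s.card))
  refine ⟨g, fun p hp => ?_⟩
  obtain ⟨i, rfl⟩ : ∃ i, s.orderEmbOfFin rfl i = p := by
    have : p ∈ Set.range (s.orderEmbOfFin rfl) := by simpa using hp
    exact this
  have := DFunLike.congr_fun hg i
  have h : g (s.orderEmbOfFin rfl i) = i.1 := this
  rw [h]
  exact i.2.trans_le hs

open Classical in
/-- A finite set that contains the possible disjuncts of a formula of the shape `D` over the symbols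
`0, …, m`. -/
noncomputable def disjuncts (Q : Finset S) (C : Finset V) (D : S → Finset V) (m : ℕ) :
    Finset (S × (V → Option ℕ)) :=
  (Q ×ˢ (Finset.univ : Finset (C → Fin (m + 1)))).image fun x =>
    (x.1, fun c => if h : c ∈ C then if c ∈ D x.1 then some (x.2 ⟨c, h⟩ : ℕ) else none else none)

theorem card_disjuncts_le (Q : Finset S) (C : Finset V) (D : S → Finset V) (m : ℕ) :
    (disjuncts Q C D m).card ≤ Q.card * (m + 1) ^ C.card := by
  classical
  refine Finset.card_image_le.trans ?_
  rw [Finset.card_product, Finset.card_univ]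
  simp

theorem Shaped.subset_disjuncts {Q : Finset S} {C : Finset V} {D : S → Finset V} {m : ℕ}
    (hC : ∀ q ∈ Q, D q ⊆ C) {Ψ : Sphere S V} (h : Shaped Q D Ψ)
    (hm : ∀ p ∈ symbols C Ψ, p < m + 1) : Ψ ⊆ disjuncts Q C D m := by
  classical
  intro d hd
  -- The default `0` is discarded by the test for use, and the reduction modulo `m + 1` changes
  -- nothing on parameters below `m + 1`.
  refine Finset.mem_image.2 ⟨(d.1, fun c => Fin.ofNat (m + 1) ((d.2 c).getD 0)),
    Finset.mem_product.2 ⟨(h d hd).1, Finset.mem_univ _⟩, Prod.ext rfl (funext fun c => ?_)⟩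
  have hc := (h d hd).2 c
  cases hx : d.2 c with
  | none =>
    have : c ∉ D d.1 := fun h' => hc.2 h' hx
    simp [this]
  | some p =>
    have hcD : c ∈ D d.1 := hc.1 (by simp [hx])
    simp [hcD, hC _ (h d hd).1 hcD, hx, Nat.mod_eq_of_lt (hm p (h.mem_symbols hC hd hx))]

/-- Spheres with at most `m + 1` parameters, none of which is a renaming of another one. -/
theorem card_le_of_distinct {Q : Finset S} {C : Finset V} {D : S → Finset V} {m : ℕ}
    (hC : ∀ q ∈ Q, D q ⊆ C) {T : Finset (Sphere S V)} (hT : ∀ ψ ∈ T, Shaped Q D ψ)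
    (hm : ∀ ψ ∈ T, (symbols C ψ).card ≤ m + 1)
    (hd : ∀ ψ ∈ T, ∀ σ ∈ T, ∀ ρ : Equiv.Perm ℕ, replace ρ ψ = σ → ψ = σ) :
    T.card ≤ 2 ^ (Q.card * (m + 1) ^ C.card) := by
  have hπ : ∀ ψ : Sphere S V, ∃ π : Equiv.Perm ℕ, ψ ∈ T → ∀ p ∈ symbols C ψ, π p < m + 1 := by
    intro ψ
    by_cases hψ : ψ ∈ T
    · obtain ⟨π, h⟩ := exists_perm_lt (hm ψ hψ)
      exact ⟨π, fun _ => h⟩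
    · exact ⟨1, fun h => absurd h hψ⟩
  choose π hπ using hπ
  calc T.card ≤ (disjuncts Q C D m).powerset.card := by
        -- Normalising the parameters is injective on `T`: if `ψ` and `σ` have the same normal form,
        -- then `(π σ)⁻¹ ∘ π ψ` renames `ψ` to `σ`.
        refine Finset.card_le_card_of_injOn (fun ψ => replace (π ψ) ψ) (fun ψ hψ => ?_) ?_
        · refine Finset.mem_coe.2 (Finset.mem_powerset.2
            (((hT ψ hψ).replace (π ψ)).subset_disjuncts hC fun p hp => ?_))
          obtain ⟨x, hx, rfl⟩ := mem_symbols_replace.1 hp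
          exact hπ ψ hψ x hx
        · intro ψ hψ σ hσ h
          refine hd ψ hψ σ hσ ((π ψ).trans (π σ).symm) ?_
          have h' := congrArg (replace (π σ).symm) (show replace (π ψ) ψ = replace (π σ) σ from h)
          rw [replace_replace, replace_replace] at h'
          rw [Equiv.coe_trans, h']
          exact replace_eq_self (by simp) σ
    _ ≤ 2 ^ (Q.card * (m + 1) ^ C.card) := by
        rw [Finset.card_powerset]
        exact Nat.pow_le_pow_right (by norm_num) (card_disjuncts_le Q C D m)

end EqForm

/-! ## Jobs -/

namespace Job

variable {Alph S V : Type*} {C : Finset V}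

/-- A true `phi` determines the equivalence as the kernel of evaluation; this separates the jobs
that share a factor. -/
theorem sat_phi (j : Job Alph S V C) (a : Alph) (ψ : Sphere S V) (η : ℕ → ℕ) :
    j.phi.Sat a ψ η ↔ ∀ t u, j.rel t u ↔ t.1.eval η = u.1.eval η := by
  classical
  refine (Form.holds_conj _ _ _).trans ?_
  simp only [Finset.mem_product, Finset.mem_attach, true_and, forall_const, Prod.forall]
  refine forall_congr' fun t => forall_congr' fun u => ?_
  by_cases h : j.rel t u <;> simp [h, Form.Holds, GuardAtom.Holds, ConfAtom.Holds]

theorem over_phi (j : Job Alph S V C) {ψ : Sphere S V}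
    (h : ∀ t ∈ EqForm.symbols C j.upd, t.Over (EqForm.symbols C ψ : Set ℕ)) :
    Form.All (GuardAtom.Over (∅ : Set (Sphere S V)) (EqForm.symbols C ψ : Set ℕ)) j.phi := by
  classical
  refine Form.all_conj fun p _ => ?_
  by_cases hp : j.rel p.1 p.2
  · rw [if_pos hp]
    exact ⟨h _ p.1.2, h _ p.2.2⟩
  · rw [if_neg hp]
    exact ⟨h _ p.1.2, h _ p.2.2⟩

theorem exists_respects (j : Job Alph S V C) : ∃ f : CTerm ℕ → ℕ, j.Respects f := by
  classical
  obtain ⟨e⟩ : Nonempty (Quotient j.rel ↪ ℕ) :=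
    ⟨(Finite.equivFin (Quotient j.rel)).toEmbedding.trans Fin.valEmbedding⟩
  refine ⟨fun t => if h : t ∈ EqForm.symbols C j.upd then e (Quotient.mk _ ⟨t, h⟩) else 0,
    fun t u => ?_⟩
  simp only [t.2, u.2, dif_pos, Subtype.coe_eta, e.injective.eq_iff]
  exact Quotient.eq

theorem exists_isAssignment (j : Job Alph S V C) (f : CTerm ℕ → ℕ) :
    ∃ asg, j.IsAssignment f asg := by
  classical
  refine ⟨fun p => if h : ∃ t ∈ EqForm.symbols C j.upd, f t = p then some h.choose else none,
    fun p t h => ?_, fun t ht => ?_⟩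
  · dsimp only at h
    by_cases hp : ∃ t ∈ EqForm.symbols C j.upd, f t = p
    · rw [dif_pos hp] at h
      obtain rfl := Option.some_injective _ h
      exact hp.choose_spec
    · rw [dif_neg hp] at h
      cases h
  · have hp : ∃ u ∈ EqForm.symbols C j.upd, f u = f t := ⟨t, ht, rfl⟩
    simp [hp]

/-- Allows a transition into an old sphere to be read as if its parameters had been chosen through
`ρ ∘ f` from the start. -/
theorem Respects.perm_comp {j : Job Alph S V C} {f : CTerm ℕ → ℕ} (h : j.Respects f)
    (ρ : Equiv.Perm ℕ) : j.Respects (ρ ∘ f) :=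
  fun t u => ρ.injective.eq_iff.trans (h t u)

theorem IsAssignment.perm_comp {j : Job Alph S V C} {f : CTerm ℕ → ℕ}
    {asg : ℕ → Option (CTerm ℕ)} (h : j.IsAssignment f asg) (ρ : Equiv.Perm ℕ) :
    j.IsAssignment (ρ ∘ f) fun p => asg (ρ.symm p) :=
  ⟨fun p t ht => ⟨(h.1 _ t ht).1, by simp [(h.1 _ t ht).2]⟩, fun t ht => by simpa using h.2 t ht⟩

/-- The sphere obtained from the update has as many parameters as the equivalence has classes. -/
theorem Respects.card_symbols_le {j : Job Alph S V C} {f : CTerm ℕ → ℕ} (h : j.Respects f) :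
    (EqForm.symbols C (EqForm.replace f j.upd)).card ≤ Nat.card (Quotient j.rel) := by
  let g : Quotient j.rel → EqForm.symbols C (EqForm.replace f j.upd) :=
    Quotient.lift (fun t => ⟨f t.1, EqForm.mem_symbols_replace.2 ⟨t.1, t.2, rfl⟩⟩)
      fun t u htu => Subtype.ext ((h t u).2 htu)
  have hg : Function.Surjective g := by
    rintro ⟨p, hp⟩
    obtain ⟨t, ht, rfl⟩ := EqForm.mem_symbols_replace.1 hp
    exact ⟨Quotient.mk _ ⟨t, ht⟩, rfl⟩
  simpa using Nat.card_le_card_of_surjective g hg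

/-- `t` is a transition that an iteration of the inner loop for `j` may add. -/
def Realizes (j : Job Alph S V C) (t : CTransition Alph (Sphere S V) ℕ) : Prop :=
  ∃ (f : CTerm ℕ → ℕ) (asg : ℕ → Option (CTerm ℕ)), j.Respects f ∧ j.IsAssignment f asg ∧
    t = ⟨j.src, Form.and j.guard j.phi, asg, EqForm.replace f j.upd⟩

end Job

/-! ### Clauses, minterms and the jobs of one sphere. -/

namespace CAut

variable {Alph S V : Type*} {A : CAut Alph S V} {D : S → Finset V} {m : ℕ}
  {ψ : Sphere S V} {X : Finset (GuardForm Alph (Sphere S V) ℕ × (S × (V → Option (CTerm ℕ))))}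
  {j : Job Alph S V A.counters}

open EqForm (Shaped)

/-- A true minterm records exactly which guards are true, so two minterms true at the same place
coincide. -/
theorem sat_minterm {G G' : Finset (GuardForm Alph (Sphere S V) ℕ)} (hG : G' ⊆ G) (a : Alph)
    (ψ : Sphere S V) (η : ℕ → ℕ) :
    (minterm G G').Sat a ψ η ↔ ∀ g ∈ G, g ∈ G' ↔ g.Sat a ψ η := by
  classical
  refine (and_congr (Form.holds_conj _ _ _) (Form.holds_conj _ _ _)).trans ⟨?_, ?_⟩
  · rintro ⟨h₁, h₂⟩ g hg
    refine ⟨h₁ g, fun h => ?_⟩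
    by_contra hn
    exact h₂ g (Finset.mem_sdiff.2 ⟨hg, hn⟩) h
  · intro h
    refine ⟨fun g hg => (h g (hG hg)).1 hg, fun g hg hs => ?_⟩
    obtain ⟨hg, hn⟩ := Finset.mem_sdiff.1 hg
    exact hn ((h g hg).2 hs)

theorem InUse.pullback_mem_confs {Y : Type*} {Ψ : EqForm S V Y} (hD : A.InUse D)
    (hΨ : Shaped A.states D Ψ) {d : S × (V → Option Y)} (hd : d ∈ Ψ) (η : Y → ℕ) :
    (d.1, pullback d.2 η) ∈ A.confs := by
  refine ⟨(hΨ d hd).1, fun v hv => ?_⟩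
  have : d.2 v = none := by
    by_contra hn
    exact hv (hD.subset _ (hΨ d hd).1 (((hΨ d hd).2 v).1 hn))
  simp [pullback, this]

/-- A disjunct fixes all counters in use at its control state, and guards depend on no others. The
existential quantifier over counter values can therefore be instantiated by the valuation
`pullback`, and one clause per matching pair of disjunct and transition suffices. -/
theorem InUse.exists_isClauses (hD : A.InUse D) (hψ : Shaped A.states D ψ) :
    ∃ X, A.IsClauses ψ X := by
  classical
  refine ⟨((ψ ×ˢ A.trans.toFinset).filter fun x => x.1.1 = x.2.src).image fun x =>
    (Form.bind (GuardAtom.elim x.1.1 x.1.2) x.2.guard, update x.1 x.2), ?_, ?_⟩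
  · rintro ⟨g, u⟩ hx
    simp only [Finset.mem_image, Finset.mem_filter, Finset.mem_product, List.mem_toFinset,
      Prod.mk.injEq] at hx
    obtain ⟨⟨d, t⟩, ⟨⟨hd, -⟩, -⟩, rfl, -⟩ := hx
    exact Form.all_bind (fun x => GuardAtom.over_elim
      (fun c p hp => hψ.mem_symbols hD.subset hd hp) _ x) _
  · intro η a u
    have hsat : ∀ (d : S × (V → Option ℕ)) (t : CTransition Alph S V),
        GuardForm.Sat (Form.bind (GuardAtom.elim d.1 d.2) t.guard) a ψ η ↔
          t.guard.Sat a d.1 (pullback d.2 η) :=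
      fun d t => Form.holds_bind (GuardAtom.sat_elim d.1 d.2 a ψ η) t.guard
    simp only [Finset.mem_image, Finset.mem_filter, Finset.mem_product, List.mem_toFinset,
      Prod.mk.injEq]
    constructor
    · rintro ⟨g, ⟨⟨d, t⟩, ⟨⟨hd, ht⟩, hs⟩, rfl, rfl⟩, hg⟩
      exact ⟨d, hd, t, ht, hs, rfl, pullback d.2 η, hD.pullback_mem_confs hψ hd η,
        fun c p hp => pullback_of_eq_some η hp, (hsat d t).1 hg⟩
    · rintro ⟨d, hd, t, ht, hs, rfl, α, -, hα, hg⟩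
      refine ⟨_, ⟨(d, t), ⟨⟨hd, ht⟩, hs⟩, rfl, rfl⟩, (hsat d t).2 ?_⟩
      rw [hs] at hg ⊢
      refine (hD.guard t ht a α _ fun c hc => ?_).1 hg
      obtain ⟨p, hp⟩ := Option.ne_none_iff_exists'.1 (((hψ d hd).2 c).2 (hs ▸ hc))
      rw [hα c p hp, pullback_of_eq_some η hp]

open Classical in
/-- A factor: a satisfiable minterm of the guards of the clauses, with the disjunction of the updates
of the clauses compatible with it. -/
def IsFactor (ψ : Sphere S V)
    (X : Finset (GuardForm Alph (Sphere S V) ℕ × (S × (V → Option (CTerm ℕ)))))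
    (guard : GuardForm Alph (Sphere S V) ℕ) (upd : EqForm S V (CTerm ℕ)) : Prop :=
  ∃ G' ⊆ X.image Prod.fst, guard = minterm (X.image Prod.fst) G' ∧
    (∃ (a : Alph) (η : ℕ → ℕ), guard.Sat a ψ η) ∧ upd = (X.filter fun x => x.1 ∈ G').image Prod.snd

variable {guard : GuardForm Alph (Sphere S V) ℕ} {upd : EqForm S V (CTerm ℕ)}

/-- The disjuncts of the update of a factor whose guard is true. -/
theorem mem_upd_of_sat (hX : A.IsClauses ψ X) (hf : IsFactor ψ X guard upd) {a : Alph} {η : ℕ → ℕ}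
    (hs : guard.Sat a ψ η) (u : S × (V → Option (CTerm ℕ))) :
    u ∈ upd ↔ ∃ d ∈ ψ, ∃ t ∈ A.trans, d.1 = t.src ∧ u = update d t ∧
      ∃ α : V → ℕ, (d.1, α) ∈ A.confs ∧
        (∀ (c : V) (p : ℕ), d.2 c = some p → α c = η p) ∧ t.guard.Sat a d.1 α := by
  classical
  obtain ⟨G', hG', hg, -, hu⟩ := hf
  rw [hg, sat_minterm hG'] at hs
  rw [← hX.2 η a u, hu]
  simp only [Finset.mem_image, Finset.mem_filter]
  constructor
  · rintro ⟨⟨g, u⟩, ⟨hx, hg'⟩, rfl⟩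
    exact ⟨g, hx, (hs g (hG' hg')).1 hg'⟩
  · rintro ⟨g, hx, hg'⟩
    exact ⟨(g, u), ⟨hx, (hs g (Finset.mem_image_of_mem _ hx)).2 hg'⟩, rfl⟩

theorem exists_isFactor (ψ : Sphere S V)
    (X : Finset (GuardForm Alph (Sphere S V) ℕ × (S × (V → Option (CTerm ℕ))))) (a : Alph)
    (η : ℕ → ℕ) : ∃ guard upd, IsFactor ψ X guard upd ∧ guard.Sat a ψ η := by
  classical
  have hs : (minterm (X.image Prod.fst) ((X.image Prod.fst).filter fun g => g.Sat a ψ η)).Sat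
      a ψ η := (sat_minterm (Finset.filter_subset _ _) a ψ η).2 fun g hg => by simp [hg]
  exact ⟨_, _, ⟨_, Finset.filter_subset _ _, rfl, ⟨a, η, hs⟩, rfl⟩, hs⟩

/-- If the terms of a factor take at most `m + 1` values, then some job for it is enabled. -/
theorem IsFactor.exists_job (hf : IsFactor ψ X guard upd) {a : Alph} {η : ℕ → ℕ} (hs : guard.Sat a ψ η)
    (hm : ∀ t ∈ EqForm.symbols A.counters upd, t.eval η ≤ m) :
    ∃ j ∈ A.jobs m ψ X, j.guard = guard ∧ j.upd = upd ∧ j.guard.Sat a ψ η ∧ j.phi.Sat a ψ η := by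
  let j : Job Alph S V A.counters :=
    -- The only equivalence compatible with `η`; its classes embed into the possible values `0, …,
    -- m`.
    ⟨ψ, guard, upd, Setoid.ker fun t : {t // t ∈ EqForm.symbols A.counters upd} => t.1.eval η⟩
  have hφ : j.phi.Sat a ψ η := (j.sat_phi a ψ η).2 fun t u => Iff.rfl
  let g : Quotient j.rel → Fin (m + 1) :=
    Quotient.lift (fun t => ⟨t.1.eval η, Nat.lt_succ_of_le (hm t.1 t.2)⟩)
      fun t u htu => Fin.ext htu
  have hg : Function.Injective g := by
    intro x y
    induction x using Quotient.inductionOn with | _ t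
    induction y using Quotient.inductionOn with | _ u
    intro h
    exact Quotient.sound (congrArg Fin.val h)
  exact ⟨j, ⟨rfl, hf, ⟨a, η, hφ⟩, by simpa using Nat.card_le_card_of_injective g hg⟩, rfl, rfl,
    hs, hφ⟩

theorem exists_update_of_mem_upd (hX : A.IsClauses ψ X) (hf : IsFactor ψ X guard upd)
    {u : S × (V → Option (CTerm ℕ))} (hu : u ∈ upd) :
    ∃ d ∈ ψ, ∃ t ∈ A.trans, d.1 = t.src ∧ u = update d t := by
  obtain ⟨a, η, hs⟩ : ∃ a η, guard.Sat a ψ η := by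
    obtain ⟨_, -, -, hs, -⟩ := hf
    exact hs
  obtain ⟨d, hd, t, ht, h, hu, -⟩ := (mem_upd_of_sat hX hf hs u).1 hu
  exact ⟨d, hd, t, ht, h, hu⟩

/-- An update assigns exactly the counters in use at its target. -/
theorem InUse.shaped_upd (hD : A.InUse D) (hA : A.WellFormed) (hψ : Shaped A.states D ψ)
    (hX : A.IsClauses ψ X) (hf : IsFactor ψ X guard upd) : Shaped A.states D upd := by
  intro u hu
  obtain ⟨d, hd, t, ht, hs, rfl⟩ := exists_update_of_mem_upd hX hf hu
  refine ⟨(hA.2.2 t ht).2.1, fun c => ?_⟩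
  rw [show (update d t).1 = t.tgt from rfl, ← hD.assign t ht c]
  cases hc : t.assign c with
  | none => simp [update, hc]
  | some τ =>
    obtain ⟨u, hu⟩ : ∃ u, τ.subst d.2 = some u :=
      CTerm.exists_subst_eq_some ((hD.term t ht c τ hc).mono fun v hv =>
        ((hψ d hd).2 v).2 (hs ▸ hv))
    simp [update, hc, hu]

theorem InUse.over_of_mem_symbols_upd (hD : A.InUse D) (hψ : Shaped A.states D ψ)
    (hX : A.IsClauses ψ X) (hf : IsFactor ψ X guard upd) {t : CTerm ℕ}
    (ht : t ∈ EqForm.symbols A.counters upd) :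
    t.Over (EqForm.symbols A.counters ψ : Set ℕ) := by
  obtain ⟨u, hu, c, -, hc⟩ := EqForm.mem_symbols.1 ht
  obtain ⟨d, hd, t', -, -, rfl⟩ := exists_update_of_mem_upd hX hf hu
  obtain ⟨τ, -, hτ⟩ : ∃ τ, t'.assign c = some τ ∧ τ.subst d.2 = some t := by
    simpa [update, Option.bind_eq_some_iff] using hc
  exact CTerm.over_of_subst_eq_some (fun v p hp => hψ.mem_symbols hD.subset hd hp) hτ

theorem over_guard (hX : A.IsClauses ψ X) (hf : IsFactor ψ X guard upd) :
    Form.All (GuardAtom.Over (∅ : Set (Sphere S V)) (EqForm.symbols A.counters ψ : Set ℕ))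
      guard := by
  classical
  obtain ⟨G', hG', hg, -⟩ := hf
  have h : ∀ g ∈ X.image Prod.fst, Form.All
      (GuardAtom.Over (∅ : Set (Sphere S V)) (EqForm.symbols A.counters ψ : Set ℕ)) g := by
    intro g hg
    obtain ⟨x, hx, rfl⟩ := Finset.mem_image.1 hg
    exact hX.1 x hx
  rw [hg]
  exact ⟨Form.all_conj fun g hg => h g (hG' hg),
    Form.all_conj fun g hg => h g (Finset.mem_sdiff.1 hg).1⟩

/-- A job is given by a subset of a finite set of guards and an equivalence on a finite set of
terms. Finiteness makes `ncard` usable in the termination measure. -/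
theorem finite_jobs (A : CAut Alph S V) (m : ℕ) (ψ : Sphere S V)
    (X : Finset (GuardForm Alph (Sphere S V) ℕ × (S × (V → Option (CTerm ℕ))))) :
    (A.jobs m ψ X).Finite := by
  classical
  let upd (G' : Finset (GuardForm Alph (Sphere S V) ℕ)) : EqForm S V (CTerm ℕ) :=
    (X.filter fun x => x.1 ∈ G').image Prod.snd
  have hfin : ∀ G', Finite (Setoid {t : CTerm ℕ // t ∈ EqForm.symbols A.counters (upd G')}) :=
    fun G' => Finite.of_injective (fun r => (r.r : _ → _ → Prop))
      fun r s h => Setoid.ext fun x y => by exact iff_of_eq (congrFun (congrFun h x) y)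
  refine Set.Finite.subset ((X.image Prod.fst).powerset.finite_toSet.biUnion fun G' _ =>
    Set.finite_range fun r => (⟨ψ, minterm (X.image Prod.fst) G', upd G', r⟩ :
      Job Alph S V A.counters)) ?_
  rintro ⟨src, guard, u, r⟩ ⟨rfl, ⟨G', hG', rfl, -, rfl⟩, -⟩
  exact Set.mem_biUnion (Finset.mem_coe.2 (Finset.mem_powerset.2 hG')) ⟨r, rfl⟩

/-- The guards of different jobs exclude each other. -/
theorem eq_of_mem_jobs_of_sat {j' : Job Alph S V A.counters} (hj : j ∈ A.jobs m ψ X)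
    (hj' : j' ∈ A.jobs m ψ X) {a : Alph} {η : ℕ → ℕ} (hg : j.guard.Sat a ψ η)
    (hφ : j.phi.Sat a ψ η) (hg' : j'.guard.Sat a ψ η) (hφ' : j'.phi.Sat a ψ η) : j = j' := by
  classical
  rw [Job.sat_phi] at hφ hφ'
  obtain ⟨src, guard, u, r⟩ := j
  obtain ⟨src', guard', u', r'⟩ := j'
  obtain ⟨rfl, ⟨G, hG, rfl, -, rfl⟩, -⟩ := hj
  obtain ⟨h, ⟨G', hG', rfl, -, rfl⟩, -⟩ := hj'
  obtain rfl : src' = src := h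
  have h₁ := (sat_minterm hG a src' η).1 hg
  have h₂ := (sat_minterm hG' a src' η).1 hg'
  obtain rfl : G = G' := by
    ext g
    exact ⟨fun h => (h₂ g (hG h)).2 ((h₁ g (hG h)).1 h),
      fun h => (h₁ g (hG' h)).2 ((h₂ g (hG' h)).1 h)⟩
  obtain rfl : r = r' := Setoid.ext fun t u => (hφ t u).trans (hφ' t u).symm
  rfl

end CAut

/-! ## Runs -/

namespace CAut

variable {Alph S V : Type*} {A : CAut Alph S V} {D : S → Finset V} {m : ℕ}

open EqForm (Shaped)

theorem mem_outcome_nil {α : S × (V → ℕ)} : α ∈ A.outcome [] ↔ α ∈ A.Initial :=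
  ⟨fun ⟨_, hβ, h⟩ => h ▸ hβ, fun h => ⟨α, h, rfl⟩⟩

theorem succWord_append_singleton {w : List Alph} {a : Alph} {α β : S × (V → ℕ)} :
    A.SuccWord (w ++ [a]) α β ↔ ∃ γ, A.SuccWord w α γ ∧ A.Succ a γ β := by
  induction w generalizing α with
  | nil => simp [SuccWord]
  | cons b w ih =>
    simp only [List.cons_append, SuccWord, ih]
    constructor
    · rintro ⟨γ, h, δ, h', h''⟩
      exact ⟨δ, ⟨γ, h, h'⟩, h''⟩
    · rintro ⟨δ, ⟨γ, h, h'⟩, h''⟩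
      exact ⟨γ, h, δ, h', h''⟩

theorem mem_outcome_append_singleton {w : List Alph} {a : Alph} {β : S × (V → ℕ)} :
    β ∈ A.outcome (w ++ [a]) ↔ ∃ γ ∈ A.outcome w, A.Succ a γ β := by
  constructor
  · rintro ⟨α, hα, h⟩
    obtain ⟨γ, h, h'⟩ := succWord_append_singleton.1 h
    exact ⟨γ, ⟨α, hα, h⟩, h'⟩
  · rintro ⟨γ, ⟨α, hα, h⟩, h'⟩
    exact ⟨α, hα, succWord_append_singleton.2 ⟨γ, h, h'⟩⟩

/-- `Φ` represents the initial configurations by equations between the counters in use and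
constants. -/
def Represents (A : CAut Alph S V) (D : S → Finset V) (Φ : EqForm S V ℕ) : Prop :=
  Shaped A.states D Φ ∧
    ∀ α ∈ A.confs, A.init.Sat α.1 α.2 ↔ EqForm.Sat Φ α.1 α.2 (fun k => k)

/-- `ψ` and `χ` are an initial sphere and the corresponding initial formula. -/
def IsInitialSphere (A : CAut Alph S V) (D : S → Finset V) (ψ : Sphere S V)
    (χ : ConfForm (Sphere S V) ℕ) : Prop :=
  ∃ (Φ : EqForm S V ℕ) (f : ℕ → ℕ), A.Represents D Φ ∧
    Set.InjOn f (EqForm.symbols A.counters Φ : Set ℕ) ∧ ψ = EqForm.replace f Φ ∧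
    χ = Form.and (Form.atom (ConfAtom.state ψ))
      (Form.conj (EqForm.symbols A.counters Φ) fun k =>
        Form.atom (ConfAtom.eq (CTerm.add (f k) 0) (CTerm.const k)))

theorem IsStart.isInitialSphere {st : RunState Alph S V A.counters} (h : A.IsStart D st) :
    A.IsInitialSphere D st.init st.initForm := by
  obtain ⟨Φ, f, h₁, h₂, h₃, h₄, h₅, -⟩ := h
  exact ⟨Φ, f, ⟨h₁, h₂⟩, h₃, h₄, h₅⟩

/-- If a formula in equations describes configurations with counters bounded by `m`, then its
symbols have values at most `m`. -/
theorem InUse.le_of_mem_symbols {X : Type*} {Ψ : EqForm S V X} (hD : A.InUse D)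
    (hΨ : Shaped A.states D Ψ) {η : X → ℕ}
    (h : ∀ α ∈ A.confs, EqForm.Sat Ψ α.1 α.2 η → ∀ c ∈ D α.1, α.2 c ≤ m) {x : X}
    (hx : x ∈ EqForm.symbols A.counters Ψ) : η x ≤ m := by
  obtain ⟨d, hd, c, -, hc⟩ := EqForm.mem_symbols.1 hx
  -- The disjunct containing `x` has a model in which some counter in use takes the value `η x`.
  have := h _ (hD.pullback_mem_confs hΨ hd η)
    ⟨d, hd, rfl, fun c x hx => pullback_of_eq_some η hx⟩ c (((hΨ d hd).2 c).1 (by simp [hc]))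
  exact (pullback_of_eq_some η hc).symm.trans_le this

theorem Represents.le_of_mem_symbols {Φ : EqForm S V ℕ} (hΦ : A.Represents D Φ) (hD : A.InUse D)
    (hm : A.BoundedBy D m) {k : ℕ} (hk : k ∈ EqForm.symbols A.counters Φ) : k ≤ m :=
  hD.le_of_mem_symbols hΦ.1 (η := fun k => k)
    (fun α hα hs => hm [] α (mem_outcome_nil.2 ⟨hα, (hΦ.2 α hα).2 hs⟩)) hk

/-- Initial configurations form the outcome of the empty word, so boundedness leaves finitely many
valuations of the counters in use; those satisfying `A.init` are collected. -/
theorem InUse.exists_represents (hD : A.InUse D) (hm : A.BoundedBy D m) :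
    ∃ Φ, A.Represents D Φ := by
  classical
  refine ⟨(EqForm.disjuncts A.states A.counters D m).filter fun d =>
    (d.1 ∈ A.states ∧ ∀ c, d.2 c ≠ none ↔ c ∈ D d.1) ∧
      A.init.Sat d.1 (pullback d.2 fun k => k), ?_, ?_⟩
  · exact fun d hd => (Finset.mem_filter.1 hd).2.1
  · rintro ⟨q, α⟩ hα
    constructor
    · intro hs
      let d : S × (V → Option ℕ) := (q, fun c => if c ∈ D q then some (α c) else none)
      have hd : Shaped A.states D {d} := by
        intro e he
        obtain rfl := Finset.mem_singleton.1 he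
        exact ⟨hα.1, fun c => by simp [d]⟩
      have hval : ∀ c p, d.2 c = some p → c ∈ D q ∧ α c = p := by
        intro c p hp
        by_cases hc : c ∈ D q
        · exact ⟨hc, by simpa [d, hc] using hp⟩
        · simp [d, hc] at hp
      refine ⟨d, Finset.mem_filter.2 ⟨?_, hd d (by simp), ?_⟩, rfl, fun c p hp => (hval c p hp).2⟩
      · refine hd.subset_disjuncts hD.subset (fun p hp => ?_) (Finset.mem_singleton_self d)
        obtain ⟨e, he, c, -, hc⟩ := EqForm.mem_symbols.1 hp
        obtain rfl := Finset.mem_singleton.1 he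
        obtain ⟨hcD, rfl⟩ := hval c p hc
        exact Nat.lt_succ_of_le (hm [] (q, α) (mem_outcome_nil.2 ⟨hα, hs⟩) c hcD)
      · refine (hD.init q hα.1 α _ fun c hc => ?_).1 hs
        simp [pullback, d, hc]
    · rintro ⟨d, hd, rfl, h⟩
      obtain ⟨-, hd, hs⟩ := Finset.mem_filter.1 hd
      refine (hD.init d.1 hα.1 _ _ fun c hc => ?_).1 hs
      obtain ⟨p, hp⟩ := Option.ne_none_iff_exists'.1 ((hd.2 c).2 hc)
      rw [pullback_of_eq_some _ hp]
      exact (h c p hp).symm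

theorem InUse.exists_isStart (hD : A.InUse D) (hm : A.BoundedBy D m) :
    ∃ st : RunState Alph S V A.counters, A.IsStart D st := by
  obtain ⟨Φ, hΦ⟩ := hD.exists_represents hm
  let ψ := EqForm.replace id Φ
  exact ⟨⟨ψ, Form.and (Form.atom (ConfAtom.state ψ)) (Form.conj (EqForm.symbols A.counters Φ) fun k =>
    Form.atom (ConfAtom.eq (CTerm.add (id k) 0) (CTerm.const k))), {ψ}, {ψ}, [], ∅⟩,
    Φ, id, hΦ.1, hΦ.2, Set.injOn_id _, rfl, rfl, rfl, rfl, rfl, rfl⟩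

/-- The job `j` belongs to a sphere that has been taken from the worklist and whose clauses are given
by `X`. -/
def IsJob (A : CAut Alph S V) (m : ℕ) (st : RunState Alph S V A.counters)
    (X : Sphere S V → Finset (GuardForm Alph (Sphere S V) ℕ × (S × (V → Option (CTerm ℕ)))))
    (j : Job Alph S V A.counters) : Prop :=
  j.src ∈ st.states ∧ j.src ∉ st.worklist ∧ j ∈ A.jobs m j.src (X j.src)

/-- The invariant of a run, where `X` gives the clauses chosen for the processed spheres and `T` the
transitions added for the completed jobs. -/
structure Invariant (A : CAut Alph S V) (D : S → Finset V) (m : ℕ)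
    (st : RunState Alph S V A.counters)
    (X : Sphere S V → Finset (GuardForm Alph (Sphere S V) ℕ × (S × (V → Option (CTerm ℕ)))))
    (T : Job Alph S V A.counters → CTransition Alph (Sphere S V) ℕ) : Prop where
  initial : A.IsInitialSphere D st.init st.initForm
  init_mem : st.init ∈ st.states
  shaped : ∀ ψ ∈ st.states, Shaped A.states D ψ
  card_symbols : ∀ ψ ∈ st.states, (EqForm.symbols A.counters ψ).card ≤ m + 1
  distinct : ∀ ψ ∈ st.states, ∀ σ ∈ st.states, ∀ ρ : Equiv.Perm ℕ,
    EqForm.replace ρ ψ = σ → ψ = σ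
  worklist : st.worklist ⊆ st.states
  finite : st.todo.Finite
  clauses : ∀ ψ ∈ st.states, ψ ∉ st.worklist → A.IsClauses ψ (X ψ)
  todo : ∀ j ∈ st.todo, A.IsJob m st X j
  trans : ∀ t ∈ st.trans, ∃ j, A.IsJob m st X j ∧ j ∉ st.todo ∧ T j = t
  completed : ∀ j, A.IsJob m st X j → j ∉ st.todo →
    T j ∈ st.trans ∧ j.Realizes (T j) ∧ (T j).tgt ∈ st.states

namespace Invariant

variable {st : RunState Alph S V A.counters}
  {X : Sphere S V → Finset (GuardForm Alph (Sphere S V) ℕ × (S × (V → Option (CTerm ℕ))))}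
  {T : Job Alph S V A.counters → CTransition Alph (Sphere S V) ℕ}

theorem shaped_upd (h : A.Invariant D m st X T) (hA : A.WellFormed) (hD : A.InUse D)
    {j : Job Alph S V A.counters} (hj : A.IsJob m st X j) : Shaped A.states D j.upd :=
  hD.shaped_upd hA (h.shaped _ hj.1) (h.clauses _ hj.1 hj.2.1) hj.2.2.2.1

open Classical in
-- Redefining the clauses at `ψ` does not disturb earlier jobs: `ψ` was still in the worklist, so
-- none of them has source `ψ`. As nothing was pending, the pending jobs are exactly those of `ψ`.
theorem pop (h : A.Invariant D m st X T) {ψ : Sphere S V} (htodo : st.todo = ∅)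
    (hψ : ψ ∈ st.worklist)
    {Y : Finset (GuardForm Alph (Sphere S V) ℕ × (S × (V → Option (CTerm ℕ))))}
    (hY : A.IsClauses ψ Y) :
    A.Invariant D m { st with worklist := st.worklist.erase ψ, todo := A.jobs m ψ Y }
      (Function.update X ψ Y) T where
  initial := h.initial
  init_mem := h.init_mem
  shaped := h.shaped
  card_symbols := h.card_symbols
  distinct := h.distinct
  worklist := (Finset.erase_subset _ _).trans h.worklist
  finite := A.finite_jobs m ψ Y
  clauses σ hσ hw := by
    by_cases hs : σ = ψ
    · subst hs
      simpa using hY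
    · rw [Function.update_of_ne hs]
      exact h.clauses σ hσ fun hw' => hw (Finset.mem_erase.2 ⟨hs, hw'⟩)
  todo j hj := by
    obtain rfl : j.src = ψ := hj.1
    exact ⟨h.worklist hψ, by simp, by simpa using hj⟩
  trans t ht := by
    obtain ⟨j, hj, -, rfl⟩ := h.trans t ht
    have hs : j.src ≠ ψ := fun hs => hj.2.1 (hs ▸ hψ)
    refine ⟨j, ⟨hj.1, fun hw => hj.2.1 (Finset.mem_of_mem_erase hw), ?_⟩, fun hj' => hs hj'.1, rfl⟩
    rw [Function.update_of_ne hs]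
    exact hj.2.2
  completed j hj hj' := by
    have hs : j.src ≠ ψ := by
      rintro rfl
      exact hj' (by simpa using hj.2.2)
    refine h.completed j ⟨hj.1, fun hw => hj.2.1 (Finset.mem_erase.2 ⟨hs, hw⟩), ?_⟩ (by simp [htodo])
    simpa [Function.update_of_ne hs] using hj.2.2

open Classical in
theorem complete (h : A.Invariant D m st X T) {j : Job Alph S V A.counters} (hj : j ∈ st.todo)
    {t : CTransition Alph (Sphere S V) ℕ} (ht : j.Realizes t) (htgt : t.tgt ∈ st.states) :
    A.Invariant D m { st with trans := t :: st.trans, todo := st.todo \ {j} } X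
      (Function.update T j t) where
  initial := h.initial
  init_mem := h.init_mem
  shaped := h.shaped
  card_symbols := h.card_symbols
  distinct := h.distinct
  worklist := h.worklist
  finite := h.finite.subset Set.sdiff_subset
  clauses := h.clauses
  todo i hi := h.todo i hi.1
  trans u hu := by
    rcases List.mem_cons.1 hu with rfl | hu
    · exact ⟨j, h.todo j hj, by simp, by simp⟩
    · obtain ⟨i, hi, hi', rfl⟩ := h.trans u hu
      exact ⟨i, hi, fun hd => hi' hd.1, Function.update_of_ne (fun hij => hi' (by rwa [hij])) _ _⟩
  completed i hi hi' := by
    by_cases hij : i = j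
    · subst hij
      simpa using ⟨ht, htgt⟩
    · rw [Function.update_of_ne hij]
      obtain ⟨h₁, h₂⟩ := h.completed i hi fun hd => hi' ⟨hd, hij⟩
      exact ⟨List.mem_cons_of_mem _ h₁, h₂⟩

open Classical in
-- The new sphere also enters the worklist, so the set of jobs to be accounted for stays the same.
theorem insert (h : A.Invariant D m st X T) {ψ : Sphere S V} (hψ : Shaped A.states D ψ)
    (hc : (EqForm.symbols A.counters ψ).card ≤ m + 1)
    (hnew : ∀ (ρ : Equiv.Perm ℕ), ∀ σ ∈ st.states, EqForm.replace ρ ψ ≠ σ) :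
    A.Invariant D m { st with
      states := Insert.insert ψ st.states, worklist := Insert.insert ψ st.worklist } X T := by
  have hmem : ψ ∉ st.states := fun hs =>
    hnew 1 ψ hs (EqForm.replace_eq_self (by simp) ψ)
  have hjob : ∀ j, A.IsJob m { st with
      states := Insert.insert ψ st.states, worklist := Insert.insert ψ st.worklist } X j ↔
      A.IsJob m st X j := by
    intro j
    constructor
    · rintro ⟨h₁, h₂, h₃⟩
      rw [Finset.mem_insert, not_or] at h₂
      exact ⟨Finset.mem_of_mem_insert_of_ne h₁ h₂.1, h₂.2, h₃⟩
    · rintro ⟨h₁, h₂, h₃⟩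
      refine ⟨Finset.mem_insert_of_mem h₁, fun hw => ?_, h₃⟩
      rcases Finset.mem_insert.1 hw with rfl | hw
      · exact hmem h₁
      · exact h₂ hw
  refine ⟨h.initial, Finset.mem_insert_of_mem h.init_mem, ?_, ?_, ?_,
    Finset.insert_subset_insert _ h.worklist, h.finite, ?_, ?_, ?_, ?_⟩
  · simpa using ⟨hψ, h.shaped⟩
  · simpa using ⟨hc, h.card_symbols⟩
  · intro σ hσ τ hτ ρ hρ
    rcases Finset.mem_insert.1 hσ with rfl | hσ' <;> rcases Finset.mem_insert.1 hτ with rfl | hτ'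
    · rfl
    · exact absurd hρ (hnew ρ τ hτ')
    · refine absurd ?_ (hnew ρ.symm σ hσ')
      rw [← hρ, EqForm.replace_replace]
      exact EqForm.replace_eq_self (by simp) σ
    · exact h.distinct σ hσ' τ hτ' ρ hρ
  · intro σ hσ hw
    rw [Finset.mem_insert, not_or] at hw
    exact h.clauses σ (Finset.mem_of_mem_insert_of_ne hσ hw.1) hw.2
  · exact fun j hj => (hjob j).2 (h.todo j hj)
  · intro t ht
    obtain ⟨j, hj, hj'⟩ := h.trans t ht
    exact ⟨j, (hjob j).2 hj, hj'⟩
  · intro j hj hj'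
    obtain ⟨h₁, h₂, h₃⟩ := h.completed j ((hjob j).1 hj) hj'
    exact ⟨h₁, h₂, Finset.mem_insert_of_mem h₃⟩

end Invariant

/-! ### Preservation of the invariant along runs. -/

theorem IsStart.exists_invariant {st : RunState Alph S V A.counters} (h : A.IsStart D st)
    (hD : A.InUse D) (hm : A.BoundedBy D m) : ∃ X T, A.Invariant D m st X T := by
  classical
  have hinit := h.isInitialSphere
  obtain ⟨Φ, f, h₁, h₂, -, h₄, -, hs, hw, ht, hj⟩ := h
  have hΦ : A.Represents D Φ := ⟨h₁, h₂⟩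
  refine ⟨fun _ => ∅, fun j => ⟨j.src, j.guard, fun _ => none, j.src⟩, hinit, by simp [hs], ?_, ?_,
    ?_, by rw [hs, hw], by simp [hj], ?_, by simp [hj], by simp [ht], ?_⟩
  · rw [hs]
    simpa [h₄] using hΦ.1.replace f
  · rw [hs]
    intro ψ hψ
    obtain rfl := Finset.mem_singleton.1 hψ
    have : EqForm.symbols A.counters st.init ⊆ (EqForm.symbols A.counters Φ).image f := by
      intro p hp
      rw [h₄] at hp
      exact Finset.mem_image.2 (EqForm.mem_symbols_replace.1 hp)
    refine (Finset.card_le_card this).trans (Finset.card_image_le.trans ?_)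
    have hr : EqForm.symbols A.counters Φ ⊆ Finset.range (m + 1) := fun k hk =>
      Finset.mem_range.2 (Nat.lt_succ_of_le (hΦ.le_of_mem_symbols hD hm hk))
    simpa using Finset.card_le_card hr
  · rw [hs]
    intro ψ hψ σ hσ _ _
    rw [Finset.mem_singleton.1 hψ, Finset.mem_singleton.1 hσ]
  · rw [hs, hw]
    exact fun ψ h h' => absurd h h'
  · rintro j ⟨h, h', -⟩
    rw [hs] at h
    rw [hw] at h'
    exact absurd h h'

theorem Step.exists_invariant {st st' : RunState Alph S V A.counters} (h : A.Step m st st')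
    (hA : A.WellFormed) (hD : A.InUse D) (hI : ∃ X T, A.Invariant D m st X T) :
    ∃ X T, A.Invariant D m st' X T := by
  classical
  obtain ⟨X, T, hI⟩ := hI
  cases h with
  | pop ψ Y htodo hψ hY => exact ⟨_, _, hI.pop htodo hψ hY⟩
  | old j f asg ρ σ hj hf hasg hσ hρ =>
    refine ⟨_, _, hI.complete hj ⟨ρ ∘ f, _, hf.perm_comp ρ, hasg.perm_comp ρ, ?_⟩ hσ⟩
    congr 1
    rw [EqForm.replace_replace] at hρ
    -- Equivalence is equality here, so the old sphere is literally the renamed computed one.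
    exact (((hI.shaped_upd hA hD (hI.todo j hj)).replace _).eq_of_equivalent
      (hI.shaped σ hσ) hρ).symm
  | new j f asg hj hf hasg hnew =>
    have hI' := hI.insert ((hI.shaped_upd hA hD (hI.todo j hj)).replace f)
      (hf.card_symbols_le.trans (hI.todo j hj).2.2.2.2.2) fun ρ σ hσ he =>
        hnew ⟨ρ, σ, hσ, EqForm.equivalent_of_eq he⟩
    exact ⟨_, _, hI'.complete hj ⟨f, asg, hf, hasg, rfl⟩ (Finset.mem_insert_self _ _)⟩

/-! ### Termination and progress. -/

theorem Invariant.card_states_le {st : RunState Alph S V A.counters}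
    (h : ∃ X T, A.Invariant D m st X T) (hD : A.InUse D) :
    st.states.card ≤ 2 ^ (A.states.card * (m + 1) ^ A.counters.card) := by
  obtain ⟨X, T, h⟩ := h
  exact EqForm.card_le_of_distinct hD.subset h.shaped h.card_symbols h.distinct

/-- A measure that decreases along runs: the number of spheres that may still be found, the size of
the worklist, the number of pending jobs. -/
noncomputable def runMeasure (A : CAut Alph S V) (m : ℕ) (st : RunState Alph S V A.counters) :
    ℕ ×ₗ ℕ ×ₗ ℕ :=
  toLex (2 ^ (A.states.card * (m + 1) ^ A.counters.card) - st.states.card,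
    toLex (st.worklist.card, st.todo.ncard))

theorem Step.runMeasure_lt {st st' : RunState Alph S V A.counters} (h : A.Step m st st')
    (hA : A.WellFormed) (hD : A.InUse D) (hI : ∃ X T, A.Invariant D m st X T) :
    A.runMeasure m st' < A.runMeasure m st := by
  classical
  -- The bound is needed after the step: only then does the truncated subtraction decrease when a
  -- sphere is added.
  have hcard := Invariant.card_states_le (h.exists_invariant hA hD hI) hD
  obtain ⟨X, T, hI⟩ := hI
  cases h with
  | pop ψ Y htodo hψ hY =>
    refine Prod.Lex.toLex_lt_toLex.2 (Or.inr ⟨rfl, Prod.Lex.toLex_lt_toLex.2 (Or.inl ?_)⟩)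
    exact Finset.card_erase_lt_of_mem hψ
  | old j f asg ρ σ hj hf hasg hσ hρ =>
    refine Prod.Lex.toLex_lt_toLex.2 (Or.inr ⟨rfl, Prod.Lex.toLex_lt_toLex.2 (Or.inr ⟨rfl, ?_⟩)⟩)
    exact Set.ncard_sdiff_singleton_lt_of_mem hj hI.finite
  | new j f asg hj hf hasg hnew =>
    refine Prod.Lex.toLex_lt_toLex.2 (Or.inl ?_)
    have hmem : EqForm.replace f j.upd ∉ st.states := fun hs =>
      hnew ⟨1, _, hs, EqForm.equivalent_of_eq (EqForm.replace_eq_self (by simp) _)⟩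
    rw [Finset.card_insert_of_notMem hmem] at hcard
    dsimp only
    rw [Finset.card_insert_of_notMem hmem]
    omega

theorem exists_invariant_of_reflTransGen {st₀ st : RunState Alph S V A.counters}
    (hA : A.WellFormed) (hD : A.InUse D) (hm : A.BoundedBy D m) (h₀ : A.IsStart D st₀)
    (h : Relation.ReflTransGen (A.Step m) st₀ st) : ∃ X T, A.Invariant D m st X T := by
  induction h with
  | refl => exact h₀.exists_invariant hD hm
  | tail _ hs ih => exact hs.exists_invariant hA hD ih

theorem not_exists_infinite_run (hA : A.WellFormed) (hD : A.InUse D) (hm : A.BoundedBy D m) :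
    ¬ ∃ run : ℕ → RunState Alph S V A.counters,
      A.IsStart D (run 0) ∧ ∀ n, A.Step m (run n) (run (n + 1)) := by
  rintro ⟨run, h₀, hs⟩
  have hI : ∀ n, ∃ X T, A.Invariant D m (run n) X T := by
    intro n
    induction n with
    | zero => exact h₀.exists_invariant hD hm
    | succ n ih => exact (hs n).exists_invariant hA hD ih
  obtain ⟨n, hn⟩ := WellFounded.not_rel_apply_succ (r := (· < ·)) fun n => A.runMeasure m (run n)
  exact hn ((hs n).runMeasure_lt hA hD (hI n))

theorem Invariant.exists_step {st : RunState Alph S V A.counters}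
    (h : ∃ X T, A.Invariant D m st X T) (hD : A.InUse D) (hf : ¬ A.Finished st) :
    ∃ st', A.Step m st st' := by
  obtain ⟨X, T, h⟩ := h
  by_cases htodo : st.todo = ∅
  · obtain ⟨ψ, hψ⟩ := Finset.nonempty_iff_ne_empty.2 fun hw => hf ⟨hw, htodo⟩
    obtain ⟨Y, hY⟩ := hD.exists_isClauses (h.shaped ψ (h.worklist hψ))
    exact ⟨_, Step.pop st ψ Y htodo hψ hY⟩
  · obtain ⟨j, hj⟩ := Set.nonempty_iff_ne_empty.2 htodo
    obtain ⟨f, hf⟩ := j.exists_respects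
    obtain ⟨asg, hasg⟩ := j.exists_isAssignment f
    by_cases hnew : ∃ (ρ : Equiv.Perm ℕ), ∃ σ ∈ st.states,
        EqForm.Equivalent (EqForm.replace ρ (EqForm.replace f j.upd)) σ
    · obtain ⟨ρ, σ, hσ, hρ⟩ := hnew
      exact ⟨_, Step.old st j f asg ρ σ hj hf hasg hσ hρ⟩
    · exact ⟨_, Step.new st j f asg hj hf hasg hnew⟩

end CAut

/-! ## The returned automaton -/

namespace CAut

variable {Alph S V : Type*} {A : CAut Alph S V} {D : S → Finset V} {m : ℕ}

open EqForm (Shaped)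

/-- Each disjunct fixes the counters on which `A.final` depends, so a disjunction of substituted
copies of `A.final` serves as `E ψ`. -/
theorem InUse.exists_isOutput (hD : A.InUse D) (st : RunState Alph S V A.counters)
    (hst : ∀ ψ ∈ st.states, Shaped A.states D ψ) :
    ∃ B : CAut Alph (Sphere S V) ℕ, A.IsOutput st B := by
  let E : Sphere S V → ConfForm (Sphere S V) ℕ := fun ψ =>
    Form.disj ψ fun d => Form.bind (ConfAtom.elim d.1 d.2) A.final
  refine ⟨⟨st.states, A.params st, A.groundInit st,
    Form.disj st.states fun ψ => Form.and (Form.atom (ConfAtom.state ψ)) (E ψ),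
    st.trans.map (A.groundTrans st)⟩, rfl, rfl, rfl, rfl, E, fun ψ hψ => ⟨?_, fun η => ?_⟩, rfl⟩
  · exact Form.all_disj fun d hd => Form.all_bind (fun x => ConfAtom.over_elim
      (fun c p hp => (hst ψ hψ).mem_symbols hD.subset hd hp) _ x) _
  · refine (Form.holds_disj _ _ _).trans ⟨?_, ?_⟩
    · rintro ⟨d, hd, h⟩
      exact ⟨(d.1, pullback d.2 η), hD.pullback_mem_confs (hst ψ hψ) hd η,
        ⟨d, hd, rfl, fun c p hp => pullback_of_eq_some η hp⟩,
        (Form.holds_bind (ConfAtom.sat_elim d.1 d.2 ψ η) A.final).1 h⟩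
    · rintro ⟨⟨q, α⟩, hα, ⟨d, hd, rfl, h⟩, hF⟩
      refine ⟨d, hd, (Form.holds_bind (ConfAtom.sat_elim d.1 d.2 ψ η) A.final).2 ?_⟩
      refine (hD.final d.1 hα.1 α _ fun c hc => ?_).1 hF
      obtain ⟨p, hp⟩ := Option.ne_none_iff_exists'.1 (((hst ψ hψ d hd).2 c).2 hc)
      exact (h c p hp).trans (pullback_of_eq_some η hp).symm

theorem mem_params {st : RunState Alph S V A.counters} {p : ℕ} :
    p ∈ A.params st ↔ ∃ ψ ∈ st.states, p ∈ EqForm.symbols A.counters ψ := by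
  simp [params]

/-- The successors of the configurations that a sphere describes. -/
theorem InUse.exists_succ_iff (hD : A.InUse D) {ψ : Sphere S V} (hψ : Shaped A.states D ψ)
    {X : Finset (GuardForm Alph (Sphere S V) ℕ × (S × (V → Option (CTerm ℕ))))}
    (hX : A.IsClauses ψ X) {guard : GuardForm Alph (Sphere S V) ℕ} {upd : EqForm S V (CTerm ℕ)}
    (hf : IsFactor ψ X guard upd) {a : Alph} {η : ℕ → ℕ} (hs : guard.Sat a ψ η)
    {R : Set (S × (V → ℕ))} (hR : ∀ α, α ∈ R ↔ α ∈ A.confs ∧ EqForm.Sat ψ α.1 α.2 η)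
    (β : S × (V → ℕ)) :
    (∃ γ ∈ R, A.Succ a γ β) ↔ β ∈ A.confs ∧ EqForm.Sat upd β.1 β.2 (CTerm.eval η) := by
  constructor
  · rintro ⟨⟨q, α⟩, hα, -, hβ, t, ht, hsrc, hg, hasg, htgt⟩
    obtain ⟨hαc, d, hd, rfl, hv⟩ := (hR _).1 hα
    refine ⟨hβ, update d t, (mem_upd_of_sat hX hf hs _).2
      ⟨d, hd, t, ht, hsrc, rfl, α, hαc, hv, hg⟩, htgt, fun c u hu => ?_⟩
    obtain ⟨τ, hτ, hu⟩ : ∃ τ, t.assign c = some τ ∧ τ.subst d.2 = some u := by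
      simpa [update, Option.bind_eq_some_iff] using hu
    rw [hasg c τ hτ, CTerm.eval_of_subst_eq_some hv hu]
  · rintro ⟨hβ, u, hu, hq, hv⟩
    obtain ⟨d, hd, t, ht, hsrc, rfl, α, hα, hαv, hg⟩ := (mem_upd_of_sat hX hf hs u).1 hu
    refine ⟨(d.1, α), (hR _).2 ⟨hα, d, hd, rfl, hαv⟩, hα, hβ, t, ht, hsrc, hg, fun c τ hτ => ?_, hq⟩
    obtain ⟨u, hu⟩ : ∃ u, τ.subst d.2 = some u :=
      CTerm.exists_subst_eq_some ((hD.term t ht c τ hτ).mono fun v hv =>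
        ((hψ d hd).2 v).2 (hsrc ▸ hv))
    rw [hv c u (by simp [update, hτ, hu]), CTerm.eval_of_subst_eq_some hαv hu]

theorem Represents.sat_iff {Φ : EqForm S V ℕ} (hΦ : A.Represents D Φ) (hD : A.InUse D)
    {f η : ℕ → ℕ} (hη : ∀ k ∈ EqForm.symbols A.counters Φ, η (f k) = k) {α : S × (V → ℕ)}
    (hα : α ∈ A.confs) :
    A.init.Sat α.1 α.2 ↔ EqForm.Sat (EqForm.replace f Φ) α.1 α.2 η := by
  rw [hΦ.2 α hα, EqForm.sat_replace]
  exact hΦ.1.sat_congr hD.subset (fun k hk => (hη k hk).symm) _ _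

/-- The configuration `β` of the constructed automaton describes the outcome of `w`. -/
structure Describes (A : CAut Alph S V) (st : RunState Alph S V A.counters) (w : List Alph)
    (β : Sphere S V × (ℕ → ℕ)) : Prop where
  mem : β.1 ∈ st.states
  eq_zero : ∀ p, p ∉ EqForm.symbols A.counters β.1 → β.2 p = 0
  outcome : ∀ α, α ∈ A.outcome w ↔ α ∈ A.confs ∧ EqForm.Sat β.1 α.1 α.2 β.2

/-! ### Correctness of the returned automaton. -/

section

variable {st : RunState Alph S V A.counters}
  {X : Sphere S V → Finset (GuardForm Alph (Sphere S V) ℕ × (S × (V → Option (CTerm ℕ))))}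
  {T : Job Alph S V A.counters → CTransition Alph (Sphere S V) ℕ} {B : CAut Alph (Sphere S V) ℕ}

/-- A parameter of the sphere carries the value of some counter in the outcome of `w`; all others
are `0`. This bounds the counters of the output. -/
theorem Describes.le (hI : A.Invariant D m st X T) (hD : A.InUse D) (hm : A.BoundedBy D m)
    {w : List Alph} {β : Sphere S V × (ℕ → ℕ)} (h : A.Describes st w β) (p : ℕ) : β.2 p ≤ m := by
  by_cases hp : p ∈ EqForm.symbols A.counters β.1
  · exact hD.le_of_mem_symbols (hI.shaped _ h.mem)
      (fun α hα hs => hm w α ((h.outcome α).2 ⟨hα, hs⟩)) hp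
  · simp [h.eq_zero p hp]

namespace IsOutput

theorem mem_initial_iff (hB : A.IsOutput st B) {β : Sphere S V × (ℕ → ℕ)} :
    β ∈ B.Initial ↔ β ∈ B.confs ∧ st.initForm.Sat β.1 β.2 ∧
      ∀ p ∈ A.params st, p ∉ EqForm.symbols A.counters st.init → β.2 p = 0 := by
  classical
  obtain ⟨-, -, hinit, -⟩ := hB
  refine and_congr_right fun _ => ?_
  rw [hinit]
  refine and_congr_right fun _ => (Form.holds_conj _ _ _).trans ?_
  simp [Form.Holds, ConfAtom.Holds, CTerm.eval]

/-- Once no job is pending, the transitions are exactly the values of `T` at the jobs; the rest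
unfolds grounding. -/
theorem succ_iff (hB : A.IsOutput st B) (hI : A.Invariant D m st X T) (hfin : A.Finished st)
    {a : Alph} {α β : Sphere S V × (ℕ → ℕ)} :
    B.Succ a α β ↔ α ∈ B.confs ∧ β ∈ B.confs ∧ ∃ j, A.IsJob m st X j ∧ α.1 = j.src ∧
      j.guard.Sat a α.1 α.2 ∧ j.phi.Sat a α.1 α.2 ∧
      (∀ p ∈ A.params st, p ∉ EqForm.symbols A.counters j.src → α.2 p = 0) ∧
      (∀ p ∈ A.params st, β.2 p = (((T j).assign p).getD (CTerm.const 0)).eval α.2) ∧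
      β.1 = (T j).tgt := by
  classical
  obtain ⟨-, -, -, htrans, -⟩ := hB
  have hzero : ∀ ψ : Sphere S V, Form.Holds (GuardAtom.Holds a α.1 α.2)
      (Form.conj (A.params st \ EqForm.symbols A.counters ψ) fun p =>
        Form.atom (GuardAtom.conf (ConfAtom.eq (CTerm.add p 0) (CTerm.const 0)))) ↔
      ∀ p ∈ A.params st, p ∉ EqForm.symbols A.counters ψ → α.2 p = 0 := by
    intro ψ
    rw [Form.holds_conj]
    simp [Form.Holds, GuardAtom.Holds, ConfAtom.Holds, CTerm.eval]
  have hcomp := fun j (hj : A.IsJob m st X j) => hI.completed j hj (by simp [hfin.2])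
  refine and_congr_right fun _ => and_congr_right fun _ => ?_
  rw [htrans]
  constructor
  · rintro ⟨t, ht, hsrc, hg, hasg, htgt⟩
    obtain ⟨t₀, ht₀, rfl⟩ := List.mem_map.1 ht
    obtain ⟨j, hj, -, rfl⟩ := hI.trans t₀ ht₀
    obtain ⟨f, asg, -, -, hT⟩ := (hcomp j hj).2.1
    have hz := (hzero _).1 hg.2
    have hg' : GuardForm.Sat (T j).guard a α.1 α.2 := hg.1
    have hs : (T j).src = j.src := by rw [hT]
    rw [hs] at hz
    rw [hT] at hg'
    refine ⟨j, hj, hsrc.trans hs, hg'.1, hg'.2, hz, fun p hp => ?_, htgt⟩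
    exact hasg p _ (by simp [groundTrans, hp])
  · rintro ⟨j, hj, hsrc, hg, hφ, hz, hasg, htgt⟩
    obtain ⟨hmem, ⟨f, asg, -, hA, hT⟩, htgt'⟩ := hcomp j hj
    have hs : (T j).src = j.src := by rw [hT]
    refine ⟨A.groundTrans st (T j), List.mem_map_of_mem hmem, hsrc.trans hs.symm,
      ⟨?_, (hzero _).2 (by rwa [hs])⟩, fun p τ hτ => ?_, htgt⟩
    · rw [hT]
      exact ⟨hg, hφ⟩
    · have hp : p ∈ A.params st := by
        by_contra hp
        have hτ' : (T j).assign p = some τ := by simpa [groundTrans, hp] using hτ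
        -- An assigned parameter occurs in the target sphere, so nothing outside `params` is
        -- assigned.
        refine hp (mem_params.2 ⟨_, htgt', ?_⟩)
        rw [hT] at hτ' ⊢
        exact EqForm.mem_symbols_replace.2 ⟨τ, hA.1 p τ hτ'⟩
      obtain rfl : ((T j).assign p).getD (CTerm.const 0) = τ := by
        simpa [groundTrans, hp] using hτ
      exact hasg p hp

theorem initial_subsingleton (hB : A.IsOutput st B) (hI : A.Invariant D m st X T) :
    B.Initial.Subsingleton := by
  obtain ⟨Φ, f, -, -, hψ, hχ⟩ := hI.initial
  have h : ∀ α ∈ B.Initial, α.1 = st.init ∧ ∀ k ∈ EqForm.symbols A.counters Φ, α.2 (f k) = k := by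
    intro α hα
    have := (hB.mem_initial_iff.1 hα).2.1
    rw [hχ] at this
    exact ⟨this.1, (Form.holds_conj _ _ _).1 this.2⟩
  intro α hα β hβ
  refine Prod.ext ((h α hα).1.trans (h β hβ).1.symm) (funext fun p => ?_)
  obtain ⟨hαc, -, hα0⟩ := hB.mem_initial_iff.1 hα
  obtain ⟨hβc, -, hβ0⟩ := hB.mem_initial_iff.1 hβ
  by_cases hp : p ∈ A.params st
  · by_cases hp' : p ∈ EqForm.symbols A.counters st.init
    · rw [hψ] at hp'
      obtain ⟨k, hk, rfl⟩ := EqForm.mem_symbols_replace.1 hp'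
      rw [(h α hα).2 k hk, (h β hβ).2 k hk]
    · rw [hα0 p hp hp', hβ0 p hp hp']
  · rw [← hB.2.1] at hp
    rw [hαc.2 p hp, hβc.2 p hp]

/-- Two enabled transitions stem from jobs of one sphere with jointly true guards, hence from the
same job, and `T` attaches a single transition to it. Grounding leaves no parameter unassigned. -/
theorem succ_unique (hB : A.IsOutput st B) (hI : A.Invariant D m st X T) (hfin : A.Finished st)
    {a : Alph} {α β γ : Sphere S V × (ℕ → ℕ)} (h : B.Succ a α β) (h' : B.Succ a α γ) : β = γ := by
  obtain ⟨-, hβ, i, hi, his, hig, hiφ, -, hia, hit⟩ := (hB.succ_iff hI hfin).1 h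
  obtain ⟨-, hγ, j, hj, hjs, hjg, hjφ, -, hja, hjt⟩ := (hB.succ_iff hI hfin).1 h'
  obtain rfl : i = j := by
    have h₁ := hi.2.2
    have h₂ := hj.2.2
    rw [← his] at h₁
    rw [← hjs] at h₂
    exact eq_of_mem_jobs_of_sat h₁ h₂ hig hiφ hjg hjφ
  refine Prod.ext (hit.trans hjt.symm) (funext fun p => ?_)
  by_cases hp : p ∈ A.params st
  · rw [hia p hp, hja p hp]
  · rw [← hB.2.1] at hp
    rw [hβ.2 p hp, hγ.2 p hp]

theorem exists_initial (hB : A.IsOutput st B) (hI : A.Invariant D m st X T) :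
    B.Initial.Nonempty := by
  classical
  obtain ⟨Φ, f, -, hf, hψ, hχ⟩ := hI.initial
  let C := EqForm.symbols A.counters Φ
  -- Injectivity of `f` on the constants lets each parameter take back the constant it replaced.
  let η : ℕ → ℕ := fun p => if h : ∃ k ∈ C, f k = p then h.choose else 0
  have hη : ∀ k ∈ C, η (f k) = k := by
    intro k hk
    have h : ∃ l ∈ C, f l = f k := ⟨k, hk, rfl⟩
    simp only [η, dif_pos h]
    exact hf h.choose_spec.1 hk h.choose_spec.2
  have hη0 : ∀ p, p ∉ EqForm.symbols A.counters st.init → η p = 0 := by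
    intro p hp
    rw [hψ, EqForm.mem_symbols_replace] at hp
    simp only [η, C, dif_neg hp]
  refine ⟨(st.init, η), hB.mem_initial_iff.2 ⟨⟨?_, fun p hp => hη0 p fun hp' => hp ?_⟩, ?_,
    fun p _ hp => hη0 p hp⟩⟩
  · rw [hB.1]
    exact hI.init_mem
  · rw [hB.2.1]
    exact mem_params.2 ⟨_, hI.init_mem, hp'⟩
  · rw [hχ]
    exact ⟨rfl, (Form.holds_conj _ _ _).2 hη⟩

theorem describes_of_mem_initial (hB : A.IsOutput st B) (hI : A.Invariant D m st X T)
    (hD : A.InUse D) {β : Sphere S V × (ℕ → ℕ)} (hβ : β ∈ B.Initial) : A.Describes st [] β := by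
  obtain ⟨Φ, f, hΦ, -, hψ, hχ⟩ := hI.initial
  obtain ⟨hβc, hs, h0⟩ := hB.mem_initial_iff.1 hβ
  obtain ⟨ψ, η⟩ := β
  rw [hχ] at hs
  obtain ⟨rfl, hs⟩ : ψ = st.init ∧ _ := hs
  refine ⟨hI.init_mem, fun p hp => ?_, fun α => ?_⟩
  · by_cases hp' : p ∈ A.params st
    · exact h0 p hp' hp
    · rw [← hB.2.1] at hp'
      exact hβc.2 p hp'
  · rw [mem_outcome_nil]
    refine and_congr_right fun hα => ?_
    rw [hΦ.sat_iff hD ((Form.holds_conj _ _ _).1 hs) hα]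
    dsimp only
    rw [hψ]

/-- After the transition the parameter `f t` holds the value that `t` had before, so the target
sphere denotes what the update denotes under the old valuation, namely the successors. -/
theorem describes_of_succ (hB : A.IsOutput st B) (hI : A.Invariant D m st X T)
    (hfin : A.Finished st) (hA : A.WellFormed) (hD : A.InUse D) {w : List Alph} {a : Alph}
    {α β : Sphere S V × (ℕ → ℕ)} (hα : A.Describes st w α) (h : B.Succ a α β) :
    A.Describes st (w ++ [a]) β := by
  obtain ⟨-, hβ, j, hj, hsrc, hg, hφ, -, hasg, htgt⟩ := (hB.succ_iff hI hfin).1 h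
  obtain ⟨-, ⟨f, asg, hf, hasg', hT⟩, hmem⟩ := hI.completed j hj (by simp [hfin.2])
  obtain ⟨ψ, η⟩ := α
  obtain ⟨σ, θ⟩ := β
  obtain rfl : ψ = j.src := hsrc
  obtain rfl : σ = (T j).tgt := htgt
  have htgt : (T j).tgt = EqForm.replace f j.upd := by rw [hT]
  have hasgT : (T j).assign = asg := by rw [hT]
  rw [hasgT] at hasg
  have hval : ∀ t ∈ EqForm.symbols A.counters j.upd, θ (f t) = t.eval η := by
    intro t ht
    obtain ⟨u, hu⟩ := Option.ne_none_iff_exists'.1 (hasg'.2 t ht)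
    obtain ⟨hu', hut⟩ := hasg'.1 _ u hu
    have hp : f t ∈ A.params st :=
      mem_params.2 ⟨_, hmem, htgt ▸ EqForm.mem_symbols_replace.2 ⟨t, ht, rfl⟩⟩
    have := hasg _ hp
    rw [hu] at this
    -- The assigned term `u` may differ from `t`, but sharing a parameter makes them equivalent, and
    -- `phi` makes their values equal.
    exact this.trans (((j.sat_phi a _ η).1 hφ ⟨u, hu'⟩ ⟨t, ht⟩).1 ((hf _ _).1 hut))
  refine ⟨hmem, fun p hp => ?_, fun γ => ?_⟩
  · by_cases hp' : p ∈ A.params st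
    · have hnone : asg p = none := by
        by_contra hn
        obtain ⟨u, hu⟩ := Option.ne_none_iff_exists'.1 hn
        exact hp (htgt ▸ EqForm.mem_symbols_replace.2 ⟨u, hasg'.1 p u hu⟩)
      have := hasg p hp'
      rw [hnone] at this
      exact this
    · rw [← hB.2.1] at hp'
      exact hβ.2 p hp'
  · have hX := hI.clauses _ hj.1 hj.2.1
    rw [mem_outcome_append_singleton,
      hD.exists_succ_iff (hI.shaped _ hj.1) hX hj.2.2.2.1 hg hα.outcome γ]
    refine and_congr_right fun _ => ?_
    dsimp only
    rw [htgt, EqForm.sat_replace]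
    exact (hI.shaped_upd hA hD hj).sat_congr hD.subset (fun t ht => (hval t ht).symm) _ _

/-- The values of the assignment terms are counter values in the outcome of `w ++ [a]`, hence at
most `m`. So the job matching the current valuation passes the restriction on the number of classes.
-/
theorem exists_succ (hB : A.IsOutput st B) (hI : A.Invariant D m st X T) (hfin : A.Finished st)
    (hA : A.WellFormed) (hD : A.InUse D) (hm : A.BoundedBy D m) {w : List Alph} (a : Alph)
    {α : Sphere S V × (ℕ → ℕ)} (hα : A.Describes st w α) : ∃ β, B.Succ a α β := by
  classical
  obtain ⟨ψ, η⟩ := α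
  have hψ : ψ ∈ st.states := hα.mem
  have hw : ψ ∉ st.worklist := by simp [hfin.1]
  have hX := hI.clauses ψ hψ hw
  obtain ⟨guard, upd, hf, hs⟩ := exists_isFactor ψ (X ψ) a η
  have hupd : Shaped A.states D upd := hD.shaped_upd hA (hI.shaped ψ hψ) hX hf
  have hle : ∀ t ∈ EqForm.symbols A.counters upd, t.eval η ≤ m := fun t ht =>
    hD.le_of_mem_symbols hupd (η := CTerm.eval η) (fun β hβ hβs => hm (w ++ [a]) β
      (mem_outcome_append_singleton.2
        ((hD.exists_succ_iff (hI.shaped ψ hψ) hX hf hs hα.outcome β).2 ⟨hβ, hβs⟩))) ht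
  obtain ⟨j, hj, -, -, hg, hφ⟩ := hf.exists_job (A := A) hs hle
  obtain rfl : j.src = ψ := hj.1
  have hjob : A.IsJob m st X j := ⟨hψ, hw, hj⟩
  obtain ⟨-, -, hmem⟩ := hI.completed j hjob (by simp [hfin.2])
  refine ⟨((T j).tgt, fun p => if p ∈ A.params st then
    (((T j).assign p).getD (CTerm.const 0)).eval η else 0), (hB.succ_iff hI hfin).2
    ⟨⟨?_, fun p hp => hα.eq_zero p fun hp' => hp ?_⟩, ⟨?_, fun p hp => ?_⟩, j, hjob, rfl, hg, hφ,
      fun p _ hp => hα.eq_zero p hp, fun p hp => by simp [hp], rfl⟩⟩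
  · rw [hB.1]
    exact hψ
  · rw [hB.2.1]
    exact mem_params.2 ⟨_, hψ, hp'⟩
  · rw [hB.1]
    exact hmem
  · rw [hB.2.1] at hp
    simp [hp]

theorem describes_of_mem_outcome (hB : A.IsOutput st B) (hI : A.Invariant D m st X T)
    (hfin : A.Finished st) (hA : A.WellFormed) (hD : A.InUse D) {w : List Alph}
    {β : Sphere S V × (ℕ → ℕ)} (hβ : β ∈ B.outcome w) : A.Describes st w β := by
  induction w using List.reverseRecOn generalizing β with
  | nil => exact hB.describes_of_mem_initial hI hD (mem_outcome_nil.1 hβ)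
  | append_singleton w a ih =>
    obtain ⟨γ, hγ, h⟩ := mem_outcome_append_singleton.1 hβ
    exact hB.describes_of_succ hI hfin hA hD (ih hγ) h

theorem outcome_nonempty (hB : A.IsOutput st B) (hI : A.Invariant D m st X T)
    (hfin : A.Finished st) (hA : A.WellFormed) (hD : A.InUse D) (hm : A.BoundedBy D m)
    (w : List Alph) : (B.outcome w).Nonempty := by
  induction w using List.reverseRecOn with
  | nil =>
    obtain ⟨β, hβ⟩ := hB.exists_initial hI
    exact ⟨β, mem_outcome_nil.2 hβ⟩
  | append_singleton w a ih =>
    obtain ⟨γ, hγ⟩ := ih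
    obtain ⟨β, hβ⟩ := hB.exists_succ hI hfin hA hD hm a
      (hB.describes_of_mem_outcome hI hfin hA hD hγ)
    exact ⟨β, mem_outcome_append_singleton.2 ⟨γ, hγ, hβ⟩⟩

theorem sat_final_iff (hB : A.IsOutput st B) {w : List Alph} {β : Sphere S V × (ℕ → ℕ)}
    (hβ : A.Describes st w β) :
    B.final.Sat β.1 β.2 ↔ ∃ α ∈ A.outcome w, A.final.Sat α.1 α.2 := by
  obtain ⟨-, -, -, -, E, hE, hF⟩ := hB
  rw [hF]
  refine (Form.holds_disj _ _ _).trans ?_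
  trans (E β.1).Sat β.1 β.2
  · constructor
    · rintro ⟨ψ, -, hs, h⟩
      obtain rfl : β.1 = ψ := hs
      exact h
    · exact fun h => ⟨β.1, hβ.mem, rfl, h⟩
  · rw [(hE β.1 hβ.mem).2 β.2]
    simp only [hβ.outcome, and_assoc]

/-- Every reachable configuration of `B` describes the outcome in `A`, which gives one inclusion.
The other also needs that `B` reaches some configuration on every word, even where the outcome in
`A` is empty. -/
theorem language_eq (hB : A.IsOutput st B) (hI : A.Invariant D m st X T)
    (hfin : A.Finished st) (hA : A.WellFormed) (hD : A.InUse D) (hm : A.BoundedBy D m) :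
    B.language = A.language := by
  ext w
  constructor
  · rintro ⟨β, hβ, hF⟩
    exact (hB.sat_final_iff (hB.describes_of_mem_outcome hI hfin hA hD hβ)).1 hF
  · intro h
    obtain ⟨β, hβ⟩ := hB.outcome_nonempty hI hfin hA hD hm w
    exact ⟨β, hβ, (hB.sat_final_iff (hB.describes_of_mem_outcome hI hfin hA hD hβ)).2 h⟩

theorem wellFormed (hB : A.IsOutput st B) (hI : A.Invariant D m st X T) (hD : A.InUse D)
    (hfin : A.Finished st) : B.WellFormed := by
  classical
  obtain ⟨hstates, hcounters, hinit, htrans, E, hE, hF⟩ := hB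
  have hsub : ∀ ψ ∈ st.states, (EqForm.symbols A.counters ψ : Set ℕ) ⊆ (A.params st : Set ℕ) :=
    fun ψ hψ p hp => mem_params.2 ⟨ψ, hψ, hp⟩
  rw [WellFormed, hstates, hcounters, hinit, htrans, hF]
  refine ⟨⟨?_, Form.all_conj fun p hp => ⟨(Finset.mem_sdiff.1 hp).1, trivial⟩⟩,
    Form.all_disj fun ψ hψ => ⟨hψ, (hE ψ hψ).1.mono fun x hx =>
      ConfAtom.Over.mono (Set.empty_subset _) (hsub ψ hψ) hx⟩, fun t ht => ?_⟩
  · obtain ⟨Φ, f, -, -, hψ, hχ⟩ := hI.initial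
    rw [hχ]
    refine ⟨hI.init_mem, Form.all_conj fun k hk => ⟨?_, trivial⟩⟩
    refine hsub _ hI.init_mem ?_
    rw [hψ]
    exact EqForm.mem_symbols_replace.2 ⟨k, hk, rfl⟩
  · obtain ⟨t₀, ht₀, rfl⟩ := List.mem_map.1 ht
    obtain ⟨j, hj, -, rfl⟩ := hI.trans t₀ ht₀
    obtain ⟨-, ⟨f, asg, -, hasg, hT⟩, hmem⟩ := hI.completed j hj (by simp [hfin.2])
    have hX := hI.clauses _ hj.1 hj.2.1
    have hψ := hI.shaped _ hj.1
    have hterm : ∀ t ∈ EqForm.symbols A.counters j.upd,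
        t.Over (EqForm.symbols A.counters j.src : Set ℕ) :=
      fun t ht => hD.over_of_mem_symbols_upd hψ hX hj.2.2.2.1 ht
    have hmono : ∀ g : GuardForm Alph (Sphere S V) ℕ, Form.All
        (GuardAtom.Over (∅ : Set (Sphere S V)) (EqForm.symbols A.counters j.src : Set ℕ)) g →
        Form.All (GuardAtom.Over (st.states : Set (Sphere S V)) (A.params st : Set ℕ)) g :=
      fun g hg => hg.mono fun x hx =>
        GuardAtom.Over.mono (Set.empty_subset _) (hsub _ hj.1) hx
    have hsrc : (T j).src = j.src := by rw [hT]
    have hguard : (T j).guard = Form.and j.guard j.phi := by rw [hT]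
    have hassign : (T j).assign = asg := by rw [hT]
    have htgt : (T j).tgt = EqForm.replace f j.upd := by rw [hT]
    refine ⟨hsrc ▸ hj.1, hmem, ⟨?_, Form.all_conj fun p hp =>
      ⟨(Finset.mem_sdiff.1 hp).1, trivial⟩⟩, fun p τ hτ => ?_⟩
    · rw [hguard]
      exact ⟨hmono _ (over_guard hX hj.2.2.2.1), hmono _ (j.over_phi hterm)⟩
    -- Assigned parameters occur in the target sphere, and the terms assigned to them use parameters
    -- of the source sphere.
    · have hover : ∀ τ, asg p = some τ → p ∈ A.params st ∧ τ.Over (A.params st : Set ℕ) := by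
        intro τ hτ
        refine ⟨mem_params.2 ⟨_, hmem, ?_⟩, (hterm τ (hasg.1 p τ hτ).1).mono (hsub _ hj.1)⟩
        rw [htgt]
        exact EqForm.mem_symbols_replace.2 ⟨τ, hasg.1 p τ hτ⟩
      simp only [groundTrans, hassign] at hτ
      by_cases hp : p ∈ A.params st
      · rw [if_pos hp] at hτ
        obtain rfl := Option.some_injective _ hτ
        refine ⟨hp, ?_⟩
        cases ha : asg p with
        | none => trivial
        | some τ => exact (hover τ ha).2
      · rw [if_neg hp] at hτ
        exact hover τ hτ

theorem isDCA (hB : A.IsOutput st B) (hI : A.Invariant D m st X T) (hfin : A.Finished st)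
    (hA : A.WellFormed) (hD : A.InUse D) (hm : A.BoundedBy D m) : B.IsDCA :=
  ⟨⟨hB.wellFormed hI hD hfin, m, fun _ _ hβ c _ =>
      (hB.describes_of_mem_outcome hI hfin hA hD hβ).le hI hD hm c⟩,
    hB.initial_subsingleton hI, fun _ _ _ _ _ _ h h' => hB.succ_unique hI hfin h h'⟩

end IsOutput

end

end CAut

/-- The terminating sphere-based determinisation. No run of the algorithm is infinite; a run can be
started, never gets stuck before its loops have ended, and then returns an automaton; and every
returned automaton is deterministic, accepts the language of the input, and obeys the bound on the
number of control states. -/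
theorem theorem1 {Alph S V : Type*} (A : CAut Alph S V) (D : S → Finset V) (m : ℕ)
    (hA : A.WellFormed) (hD : A.InUse D) (hm : A.BoundedBy D m) :
    (¬ ∃ run : ℕ → RunState Alph S V A.counters,
      A.IsStart D (run 0) ∧ ∀ n, A.Step m (run n) (run (n + 1))) ∧
    (∃ st : RunState Alph S V A.counters, A.IsStart D st) ∧
    ∀ st₀ st : RunState Alph S V A.counters,
      A.IsStart D st₀ → Relation.ReflTransGen (A.Step m) st₀ st →
      (¬ A.Finished st → ∃ st', A.Step m st st') ∧
      (A.Finished st →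
        (∃ B : CAut Alph (Sphere S V) ℕ, A.IsOutput st B) ∧
        ∀ B : CAut Alph (Sphere S V) ℕ, A.IsOutput st B →
          B.IsDCA ∧ B.language = A.language ∧
          B.states.card ≤ 2 ^ (A.states.card * (m + 1) ^ A.counters.card)) := by

  refine ⟨CAut.not_exists_infinite_run hA hD hm, hD.exists_isStart hm, fun st₀ st h₀ h => ?_⟩
  have hI := CAut.exists_invariant_of_reflTransGen hA hD hm h₀ h
  refine ⟨CAut.Invariant.exists_step hI hD, fun hfin => ?_⟩
  have hcard := CAut.Invariant.card_states_le hI hD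
  obtain ⟨X, T, hI⟩ := hI
  refine ⟨hD.exists_isOutput st hI.shaped, fun B hB => ⟨hB.isDCA hI hfin hA hD hm,
    hB.language_eq hI hfin hA hD hm, ?_⟩⟩
  rw [hB.1]
  exact hcard
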